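/- All graphs are finite, simple and undirected. Two vertices $u,v$ of a graph $G$ are \emph{twins} if they have the same closed neighborhood, $N_G[u]=N_G[v]$. A \emph{twin-cover} of $G$ is a set $X\subseteq V(G)$ such that for every edge $\{u,v\}$ of $G$ we have $u\in X$, or $v\in X$, or $u$ and $v$ are twins. For a graph $H$, a graph $G$ is \emph{$H$-colorable} if there is a homomorphism from $G$ to $H$, and $\Delta(H)$ denotes the maximum degree of $H$. **Theorem.** Let $H$ be a fixed non-bipartite graph (without self-loops). Then $H$-Coloring parameterized by the size $k$ of a twin-cover has a kernel with $\mathcal{O}(k^{\Delta(H)})$ vertices and edges that can be encoded in $\mathcal{O}(k^{\Delta(H)}\log k)$ bits, whose output is a subgraph of the input graph and which does not need a twin-cover as part of its input. That is, there is a polynomial-time algorithm that, given only a graph $G$, outputs a graph $G'$ such that 1. $G'$ is $H$-colorable if and only if $G$ is $H$-colorable; 2. $G'$ is (up to renaming of its vertices) a subgraph of $G$; 3. for every $k$, if $G$ has a twin-cover of size at most $k$, then so does $G'$, so that $(G',k)$ is again an instance of the parameterized problem; 4. there is a constant $C$, depending only on $H$, such that for every $k\ge 2$, if $G$ has a twin-cover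 of size at most $k$, then $G'$ has at most $C\,k^{\Delta(H)}$ vertices and at most $C\,k^{\Delta(H)}$ edges, and its adjacency-list encoding has at most $C\,k^{\Delta(H)}\log k$ bits. -/

import Mathlib

namespace TwinCoverKernel

/-! ### Graphs, twin-covers, H-colorability -/

/-- A finite simple graph, on the vertices `0, …, n - 1`: the instances of `H`-Coloring. -/
structure FinGraph where
  /-- the number of vertices -/
  n : ℕ
  /-- the adjacency relation -/
  graph : SimpleGraph (Fin n)

/-- `u` and `v` are (true) twins: they have the same closed neighborhood. -/
def Twins {V : Type*} (G : SimpleGraph V) (u v : V) : Prop :=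
  insert u (G.neighborSet u) = insert v (G.neighborSet v)

/-- `X` is a twin-cover of `G`: each edge has an endpoint in `X` or joins two twins. -/
def IsTwinCover {V : Type*} (G : SimpleGraph V) (X : Set V) : Prop :=
  ∀ u v : V, G.Adj u v → u ∈ X ∨ v ∈ X ∨ Twins G u v

/-- `G` has a twin-cover with at most `k` vertices. -/
def HasTwinCover (G : FinGraph) (k : ℕ) : Prop :=
  ∃ X : Finset (Fin G.n), X.card ≤ k ∧ IsTwinCover G.graph (X : Set (Fin G.n))

/-- `G` is `H`-colorable: there is a homomorphism from `G` to `H`. -/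
def HColorable {W : Type*} (H : SimpleGraph W) (G : FinGraph) : Prop :=
  Nonempty (G.graph →g H)

/-- `G'` is, up to the names of its vertices, a (not necessarily induced) subgraph of `G`. -/
def IsSubgraphOf (G' G : FinGraph) : Prop :=
  ∃ S : G.graph.Subgraph, Nonempty (G'.graph ≃g S.coe)

/-! ### Adjacency-list encoding of graphs by bit strings -/

/-- A self-delimiting code for a number: each binary digit `b` becomes the pair `1b`
(least significant digit first), and the pair `01` closes the number. -/
def encodeNat (m : ℕ) : List Bool :=
  (Nat.bits m).flatMap (fun b => [true, b]) ++ [false, true]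

open Classical in
/-- The neighbors of `v`, in increasing order. -/
noncomputable def neighborList (G : FinGraph) (v : Fin G.n) : List (Fin G.n) :=
  (List.finRange G.n).filter (fun u => G.graph.Adj v u)

/-- The adjacency-list encoding: for each vertex, in order, the codes of its neighbors, closed by
the pair `00`. -/
noncomputable def encodeGraph (G : FinGraph) : List Bool :=
  (List.finRange G.n).flatMap fun v =>
    (neighborList G v).flatMap (fun u => encodeNat u.val) ++ [false, false]

/-! ### A model of computation with running times

Programs of a small first-order language transform binary trees (cons cells). A program is a finite
syntactic object. Every elementary operation is charged the full size of the trees that it reads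
and writes, so a Turing machine simulates a run within a number of steps polynomial in its cost;
conversely one step of a multi-tape Turing machine is a bounded number of operations on a tree that
represents its configuration. Hence "polynomial time" has its usual meaning. -/

/-- The data: finite binary trees. -/
inductive Val : Type
  | nil : Val
  | node : Val → Val → Val

/-- The number of nodes and leaves of a tree. -/
def Val.size : Val → ℕ
  | .nil => 1
  | .node a b => a.size + b.size + 1

/-- The left subtree (`nil` for `nil`). -/
def Val.left : Val → Val
  | .nil => .nil
  | .node a _ => a

/-- The right subtree (`nil` for `nil`). -/
def Val.right : Val → Val
  | .nil => .nil
  | .node _ b => b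

/-- A bit string as a tree: a right comb whose left subtrees are `nil` for the bit `false` and
`node nil nil` for the bit `true`. -/
def Val.ofBits : List Bool → Val
  | [] => .nil
  | false :: l => .node .nil (Val.ofBits l)
  | true :: l => .node (.node .nil .nil) (Val.ofBits l)

/-- Programs. -/
inductive Prog : Type
  /-- return the input -/
  | id : Prog
  /-- return `nil` -/
  | nil : Prog
  /-- return the left subtree of the input -/
  | left : Prog
  /-- return the right subtree of the input -/
  | right : Prog
  /-- run two programs on the input and join their results by a node -/
  | pair : Prog → Prog → Prog
  /-- `comp p q`: run `q`, then run `p` on its result -/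
  | comp : Prog → Prog → Prog
  /-- `ite c p q`: run `p` on the input if `c` returns something else than `nil`, otherwise `q` -/
  | ite : Prog → Prog → Prog → Prog
  /-- `loop p`: as long as the left subtree of the current tree is not `nil`, apply `p` to it -/
  | loop : Prog → Prog

/-- `Runs p x y t`: on input `x` the program `p` halts with output `y`, at the cost `t`. -/
inductive Runs : Prog → Val → Val → ℕ → Prop
  | id (x : Val) : Runs .id x x (x.size + 1)
  | nil (x : Val) : Runs .nil x .nil (x.size + 1)
  | left (x : Val) : Runs .left x x.left (x.size + 1)
  | right (x : Val) : Runs .right x x.right (x.size + 1)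
  | pair {p q : Prog} {x y z : Val} {s t : ℕ} :
      Runs p x y s → Runs q x z t → Runs (.pair p q) x (.node y z) (s + t + y.size + z.size + 1)
  | comp {p q : Prog} {x y z : Val} {s t : ℕ} :
      Runs q x y s → Runs p y z t → Runs (.comp p q) x z (s + t + 1)
  | ite_then {c p q : Prog} {x b y : Val} {s t : ℕ} :
      Runs c x b s → b ≠ .nil → Runs p x y t → Runs (.ite c p q) x y (s + t + 1)
  | ite_else {c p q : Prog} {x y : Val} {s t : ℕ} :
      Runs c x .nil s → Runs q x y t → Runs (.ite c p q) x y (s + t + 1)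
  | loop_stop {p : Prog} {x : Val} :
      x.left = .nil → Runs (.loop p) x x (x.size + 1)
  | loop_step {p : Prog} {x y z : Val} {s t : ℕ} :
      x.left ≠ .nil → Runs p x y s → Runs (.loop p) y z t →
        Runs (.loop p) x z (s + t + x.size + 1)

/-- The program `p` computes the graph transformation `f`, from encoding to encoding, in time
polynomial in the length of the encoding of the input. -/
def ComputesInPolyTime (p : Prog) (f : FinGraph → FinGraph) : Prop :=
  ∃ P : Polynomial ℕ, ∀ G : FinGraph, ∃ t : ℕ, t ≤ P.eval (encodeGraph G).length ∧
    Runs p (Val.ofBits (encodeGraph G)) (Val.ofBits (encodeGraph (f G))) t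

end TwinCoverKernel

/-!
A twin-cover `X` splits the rest of `G` into cliques `K` of twins. A coloring of `X` extends to `K`
if and only if `H` has a clique of `|K|` vertices adjacent to all the colors on `N(K) ∩ X`. If it
does not extend, this is already witnessed by a set `S` of neighbors that carries pairwise different
colors and has `|K| + |S| ≤ D + 2`, where `D` is the maximum degree of `H`
(`Extends.card_le_of_minimal`): all but one of the colors of `S`, and all but one of the vertices of
a clique, are neighbors of one vertex of `H`. So it suffices to keep, for each such constraint
`(K, S)`, the edges inside `K` and between `K` and `S`, and one constraint for each pair `(|K|, S)`.
There are `O(|X| ^ D)` of these pairs, except for those with `|K| = 1` and `|S| = D + 1`.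

For the latter the number is reduced by linear algebra over the field with two elements. The
constraint `S` is represented by the boundary of the simplex `S`, that is, by the sum of its facets,
which are sets of size `D`; a basis of the span of all these vectors has at most `O(|X| ^ D)`
elements. For a set `B` of `D` colors, consider the linear functional that maps a facet to `1` if
its colors are exactly `B`. If the coloring extends to the vertex `K`, then `S` has at most `D`
colors, and an even number of facets carries the colors `B` (`sum_facets_eq_zero`). If `S` has
`D + 1` different colors, then for `B` consisting of all but one of them there is exactly one such
facet (`sum_facets_eq_one`). Hence if the constraints of a basis are satisfied, so are all the
others (`evalFunctional_eq_zero_of_selectBasis`).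

A twin-cover is computed greedily, as a union of twin classes: whenever an edge between vertices
that are not twins is uncovered, both of their classes are added. Any twin-cover contains one of the
two classes, so at most `2 (D + 2) k` vertices are taken if classes have been cut to `D + 2`
members, and cutting is harmless because `D + 2` pairwise adjacent vertices cannot be colored. The
edges of the kernel are closed under replacing a vertex by a twin, so twins of `G` remain twins, and
each twin-cover of `G` restricts to one of the kernel.

The running time is obtained from closure properties of the class `PolyTime` of functions that
programs compute in polynomial time: composition, pairing, case distinction, loops over a stack
whose contents stay of polynomial size, and consequently the usual list operations.
-/

namespace TwinCoverKernel

/-! ### Polynomial-time functions between encoded types -/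

theorem Val.size_left_le (x : Val) : x.left.size ≤ x.size := by
  cases x <;> simp [Val.left, Val.size]; omega

theorem Val.size_right_le (x : Val) : x.right.size ≤ x.size := by
  cases x <;> simp [Val.right, Val.size]; omega

theorem Val.size_pos (x : Val) : 1 ≤ x.size := by
  cases x <;> simp [Val.size]

/-- Whether a tree is `nil`. -/
def Val.isNil : Val → Bool
  | .nil => true
  | .node _ _ => false

/-- The cost of a run pays for writing its output. -/
theorem Runs.size_le {p : Prog} {x y : Val} {t : ℕ} (h : Runs p x y t) : y.size ≤ t := by
  induction h with
  | id x => omega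
  | nil x => simp [Val.size]
  | left x => have := x.size_left_le; omega
  | right x => have := x.size_right_le; omega
  | pair _ _ _ _ => simp only [Val.size]; omega
  | _ => omega

/-- A type whose elements are represented by trees. -/
class Enc (α : Type) where
  /-- the tree that represents an element -/
  enc : α → Val

open Enc

/-- Different elements are represented by different trees. -/
class LawfulEnc (α : Type) [Enc α] : Prop where
  inj : Function.Injective (enc : α → Val)

instance : Enc Val := ⟨id⟩

instance : Enc Unit := ⟨fun _ => .nil⟩

instance : LawfulEnc Unit := ⟨fun _ _ _ => rfl⟩

/-- A bit as a tree, in the same way as in `Val.ofBits`. -/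
def encBool : Bool → Val
  | false => .nil
  | true => .node .nil .nil

instance : Enc Bool := ⟨encBool⟩

instance : LawfulEnc Bool :=
  ⟨by intro a b; cases a <;> cases b <;> simp [enc, encBool]⟩

instance {α β : Type} [Enc α] [Enc β] : Enc (α × β) := ⟨fun x => .node (enc x.1) (enc x.2)⟩

instance {α β : Type} [Enc α] [Enc β] [LawfulEnc α] [LawfulEnc β] : LawfulEnc (α × β) :=
  ⟨by
    rintro ⟨a, b⟩ ⟨c, d⟩ h
    simp only [enc, Val.node.injEq] at h
    rw [LawfulEnc.inj h.1, LawfulEnc.inj h.2]⟩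

/-- A list as a right comb. -/
def encList {α : Type} [Enc α] : List α → Val
  | [] => .nil
  | a :: l => .node (enc a) (encList l)

instance {α : Type} [Enc α] : Enc (List α) := ⟨encList⟩

instance {α : Type} [Enc α] [LawfulEnc α] : LawfulEnc (List α) := ⟨by
  intro l
  induction l with
  | nil => intro l'; cases l' <;> simp [enc, encList]
  | cons a l ih =>
    intro l'
    cases l' with
    | nil => simp [enc, encList]
    | cons b l' =>
      simp only [enc, encList, Val.node.injEq]
      rintro ⟨h₁, h₂⟩
      rw [LawfulEnc.inj h₁, ih h₂]⟩

theorem natBits_injective : Function.Injective Nat.bits := by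
  intro m n h
  apply Nat.eq_of_testBit_eq
  intro i
  rw [Nat.testBit_eq_inth, Nat.testBit_eq_inth, h]

/-- Natural numbers are represented by their binary digits, least significant digit first. -/
instance : Enc ℕ := ⟨fun n => enc (Nat.bits n)⟩

instance : LawfulEnc ℕ := ⟨fun _ _ h => natBits_injective (LawfulEnc.inj h)⟩

section
variable {α β γ δ : Type} [Enc α] [Enc β] [Enc γ] [Enc δ]

@[simp] theorem enc_prod (x : α × β) : enc x = .node (enc x.1) (enc x.2) := rfl
@[simp] theorem enc_list_nil : enc ([] : List α) = .nil := rfl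
@[simp] theorem enc_list_cons (a : α) (l : List α) : enc (a :: l) = .node (enc a) (enc l) := rfl
@[simp] theorem enc_false : enc false = .nil := rfl
@[simp] theorem enc_true : enc true = .node .nil .nil := rfl
theorem enc_nat (n : ℕ) : enc n = enc (Nat.bits n) := rfl

/-- The size of the representation of `a`. -/
def esize (a : α) : ℕ := (enc a).size

theorem esize_prod (x : α × β) : esize x = esize x.1 + esize x.2 + 1 := rfl
theorem esize_mk (a : α) (b : β) : esize (a, b) = esize a + esize b + 1 := rfl
theorem esize_nil : esize ([] : List α) = 1 := rfl
theorem esize_cons (a : α) (l : List α) : esize (a :: l) = esize a + esize l + 1 := rfl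
theorem esize_pos (a : α) : 1 ≤ esize a := Val.size_pos _
theorem esize_bool_le (b : Bool) : esize b ≤ 3 := by cases b <;> simp [esize, Val.size]

theorem length_le_esize (l : List α) : l.length ≤ esize l := by
  induction l with
  | nil => simp
  | cons a l ih => rw [esize_cons, List.length_cons]; omega

theorem esize_append (l₁ l₂ : List α) : esize (l₁ ++ l₂) + 1 = esize l₁ + esize l₂ := by
  induction l₁ with
  | nil => simp [esize_nil]; omega
  | cons a l ih => rw [List.cons_append, esize_cons, esize_cons]; omega

theorem esize_reverse (l : List α) : esize l.reverse = esize l := by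
  induction l with
  | nil => rfl
  | cons a l ih =>
    have := esize_append l.reverse [a]
    rw [List.reverse_cons, esize_cons]
    rw [esize_cons, esize_nil] at this
    omega

theorem esize_mem_le {a : α} {l : List α} (h : a ∈ l) : esize a ≤ esize l := by
  induction l with
  | nil => simp at h
  | cons b l ih =>
    rw [esize_cons]
    rcases List.mem_cons.1 h with rfl | h
    · omega
    · have := ih h; omega

theorem esize_list_le {l : List α} {M : ℕ} (h : ∀ a ∈ l, esize a ≤ M) :
    esize l ≤ l.length * (M + 1) + 1 := by
  induction l with
  | nil => simp [esize_nil]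
  | cons a l ih =>
    have h₁ := h a (by simp)
    have h₂ := ih fun b hb => h b (by simp [hb])
    rw [esize_cons, List.length_cons, add_one_mul]
    omega

/-- `b` is bounded by a polynomial in the size of its argument. -/
def PolyBounded (b : α → ℕ) : Prop := ∃ P : Polynomial ℕ, ∀ a, b a ≤ P.eval (esize a)

theorem eval_mono (P : Polynomial ℕ) {m n : ℕ} (h : m ≤ n) : P.eval m ≤ P.eval n := by
  rw [Polynomial.eval_eq_sum_range, Polynomial.eval_eq_sum_range]
  gcongr

theorem PolyBounded.of_le {b c : α → ℕ} (hc : PolyBounded c) (h : ∀ a, b a ≤ c a) :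
    PolyBounded b := by
  obtain ⟨P, hP⟩ := hc
  exact ⟨P, fun a => (h a).trans (hP a)⟩

theorem PolyBounded.const (n : ℕ) : PolyBounded fun _ : α => n :=
  ⟨Polynomial.C n, fun _ => by simp⟩

theorem PolyBounded.add {b c : α → ℕ} (hb : PolyBounded b) (hc : PolyBounded c) :
    PolyBounded fun a => b a + c a := by
  obtain ⟨P, hP⟩ := hb
  obtain ⟨Q, hQ⟩ := hc
  exact ⟨P + Q, fun a => by rw [Polynomial.eval_add]; exact add_le_add (hP a) (hQ a)⟩

theorem PolyBounded.mul {b c : α → ℕ} (hb : PolyBounded b) (hc : PolyBounded c) :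
    PolyBounded fun a => b a * c a := by
  obtain ⟨P, hP⟩ := hb
  obtain ⟨Q, hQ⟩ := hc
  exact ⟨P * Q, fun a => by rw [Polynomial.eval_mul]; exact Nat.mul_le_mul (hP a) (hQ a)⟩

theorem PolyBounded.eval (Q : Polynomial ℕ) {b : α → ℕ} (hb : PolyBounded b) :
    PolyBounded fun a => Q.eval (b a) := by
  obtain ⟨P, hP⟩ := hb
  exact ⟨Q.comp P, fun a => by rw [Polynomial.eval_comp]; exact eval_mono Q (hP a)⟩

theorem PolyBounded.comp {b : β → ℕ} {f : α → β} (hb : PolyBounded b)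
    (hf : PolyBounded fun a => esize (f a)) : PolyBounded fun a => b (f a) := by
  obtain ⟨P, hP⟩ := hb
  exact (PolyBounded.eval P hf).of_le fun a => hP (f a)

theorem polyBounded_esize : PolyBounded (esize : α → ℕ) := ⟨Polynomial.X, fun _ => by simp⟩

/-- `f` is computed by a program, from representation to representation, in time polynomial in the
size of the representation of the argument. -/
def PolyTime (f : α → β) : Prop :=
  ∃ p : Prog, ∃ T : α → ℕ, PolyBounded T ∧ ∀ a, ∃ t ≤ T a, Runs p (enc a) (enc (f a)) t

namespace PolyTime

/-- The output of a polynomial-time function has polynomial size. -/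
theorem bounded {f : α → β} (hf : PolyTime f) : PolyBounded fun a => esize (f a) := by
  obtain ⟨p, T, hT, h⟩ := hf
  refine hT.of_le fun a => ?_
  obtain ⟨t, ht, hr⟩ := h a
  exact hr.size_le.trans ht

/-- Only the representations matter. -/
theorem of_enc_eq {f : α → β} {g : α → γ} (hf : PolyTime f) (h : ∀ a, enc (f a) = enc (g a)) :
    PolyTime g := by
  obtain ⟨p, T, hT, hr⟩ := hf
  exact ⟨p, T, hT, fun a => by rw [← h a]; exact hr a⟩

theorem comp {g : β → γ} {f : α → β} (hg : PolyTime g) (hf : PolyTime f) :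
    PolyTime fun a => g (f a) := by
  have hs := hf.bounded
  obtain ⟨p, T, hT, hr⟩ := hf
  obtain ⟨q, U, hU, hq⟩ := hg
  refine ⟨.comp q p, _, (hT.add (hU.comp hs)).add (.const 1), fun a => ?_⟩
  obtain ⟨s, hs, h₁⟩ := hr a
  obtain ⟨t, ht, h₂⟩ := hq (f a)
  exact ⟨s + t + 1, by omega, .comp h₁ h₂⟩

theorem id' : PolyTime fun a : α => a :=
  ⟨.id, _, polyBounded_esize.add (.const 1), fun _ => ⟨_, le_rfl, .id _⟩⟩

theorem mk {f : α → β} {g : α → γ} (hf : PolyTime f) (hg : PolyTime g) :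
    PolyTime fun a => (f a, g a) := by
  have h₁ := hf.bounded
  have h₂ := hg.bounded
  obtain ⟨p, T, hT, hr⟩ := hf
  obtain ⟨q, U, hU, hq⟩ := hg
  refine ⟨.pair p q, _, (((hT.add hU).add h₁).add h₂).add (.const 1), fun a => ?_⟩
  obtain ⟨s, hs, h₁⟩ := hr a
  obtain ⟨t, ht, h₂⟩ := hq a
  exact ⟨_, by simp only [esize]; omega, .pair h₁ h₂⟩

theorem fst {f : α → β × γ} (hf : PolyTime f) : PolyTime fun a => (f a).1 :=
  comp (g := Prod.fst) ⟨.left, _, polyBounded_esize.add (.const 1),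
    fun x => ⟨_, le_rfl, .left (enc x)⟩⟩ hf

theorem snd {f : α → β × γ} (hf : PolyTime f) : PolyTime fun a => (f a).2 :=
  comp (g := Prod.snd) ⟨.right, _, polyBounded_esize.add (.const 1),
    fun x => ⟨_, le_rfl, .right (enc x)⟩⟩ hf

theorem const_aux (v : Val) : PolyTime fun _ : α => v := by
  induction v with
  | nil => exact ⟨.nil, _, polyBounded_esize.add (.const 1), fun _ => ⟨_, le_rfl, .nil _⟩⟩
  | node x y hx hy => exact (hx.mk hy).of_enc_eq fun _ => rfl

theorem const (b : β) : PolyTime fun _ : α => b :=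
  (const_aux (enc b)).of_enc_eq fun _ => rfl

theorem ite_isNil {c : α → Val} {f g : α → β} (hc : PolyTime c) (hf : PolyTime f)
    (hg : PolyTime g) : PolyTime fun a => if (c a).isNil then f a else g a := by
  obtain ⟨r, S, hS, hr⟩ := hc
  obtain ⟨p, T, hT, hp⟩ := hf
  obtain ⟨q, U, hU, hq⟩ := hg
  refine ⟨.ite r q p, _, ((hS.add hT).add hU).add (.const 1), fun a => ?_⟩
  obtain ⟨s, hs, h₁⟩ := hr a
  obtain ⟨t, ht, h₂⟩ := hp a
  obtain ⟨u, hu, h₃⟩ := hq a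
  change Runs r (enc a) (c a) s at h₁
  cases h : c a with
  | nil =>
    rw [h] at h₁
    simp only [h]
    exact ⟨s + t + 1, by omega, .ite_else h₁ h₂⟩
  | node x y =>
    rw [h] at h₁
    simp only [h]
    exact ⟨s + u + 1, by omega, .ite_then h₁ (by simp) h₃⟩

theorem ite {c : α → Bool} {f g : α → β} (hc : PolyTime c) (hf : PolyTime f) (hg : PolyTime g) :
    PolyTime fun a => if c a then f a else g a :=
  (ite_isNil (c := fun a => enc (c a)) (hc.of_enc_eq fun _ => rfl) hg hf).of_enc_eq fun a => by
    cases c a <;> rfl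

theorem val_left {f : α → Val} (hf : PolyTime f) : PolyTime fun a => (f a).left :=
  comp (g := Val.left) ⟨.left, _, polyBounded_esize.add (.const 1),
    fun x => ⟨_, le_rfl, .left (enc x)⟩⟩ hf

theorem val_right {f : α → Val} (hf : PolyTime f) : PolyTime fun a => (f a).right :=
  comp (g := Val.right) ⟨.right, _, polyBounded_esize.add (.const 1),
    fun x => ⟨_, le_rfl, .right (enc x)⟩⟩ hf

theorem not {c : α → Bool} (hc : PolyTime c) : PolyTime fun a => !(c a) :=
  (hc.ite (const false) (const true)).of_enc_eq fun a => by cases c a <;> rfl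

theorem and {c d : α → Bool} (hc : PolyTime c) (hd : PolyTime d) : PolyTime fun a => c a && d a :=
  (hc.ite hd (const false)).of_enc_eq fun a => by cases c a <;> rfl

theorem or {c d : α → Bool} (hc : PolyTime c) (hd : PolyTime d) : PolyTime fun a => c a || d a :=
  (hc.ite (const true) hd).of_enc_eq fun a => by cases c a <;> rfl

theorem cons {f : α → β} {l : α → List β} (hf : PolyTime f) (hl : PolyTime l) :
    PolyTime fun a => f a :: l a :=
  (hf.mk hl).of_enc_eq fun _ => rfl

end PolyTime

/-- Case distinction on a list. -/
def lcase {α β : Type} (l : List α) (d : β) (g : α → List α → β) : β :=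
  match l with
  | [] => d
  | b :: t => g b t

namespace PolyTime

theorem lcase {l : α → List β} {f : α → γ} {g : α → β → List β → γ} (hl : PolyTime l)
    (hf : PolyTime f) (hg : PolyTime fun x : α × (β × List β) => g x.1 x.2.1 x.2.2) :
    PolyTime fun a => lcase (l a) (f a) (g a) := by
  have hi : PolyTime fun a : α => a := id'
  have hb := (hi.mk hl).bounded
  obtain ⟨r, S, hS, hr⟩ := hl
  obtain ⟨m, M, hM, hm⟩ := hi.mk (⟨r, S, hS, hr⟩ : PolyTime l)
  obtain ⟨p, T, hT, hp⟩ := hf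
  obtain ⟨q, U, hU, hq⟩ := hg
  obtain ⟨P, hP⟩ := hU
  refine ⟨.ite r (.comp q m) p, _,
    (((hS.add hT).add (PolyBounded.eval P hb)).add hM).add (.const 2), fun a => ?_⟩
  obtain ⟨s, hs, h₁⟩ := hr a
  obtain ⟨t, ht, h₂⟩ := hp a
  obtain ⟨w, hw, h₄⟩ := hm a
  cases h : l a with
  | nil =>
    rw [h] at h₁
    simp only [h]
    exact ⟨s + t + 1, by omega, .ite_else h₁ h₂⟩
  | cons b k =>
    obtain ⟨u, hu, h₃⟩ := hq (a, b, k)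
    have hu' := hu.trans (hP _)
    change u ≤ P.eval (esize (a, b :: k)) at hu'
    refine ⟨s + (w + u + 1) + 1, by omega, ?_⟩
    simp only [h] at h₁ h₄ ⊢
    exact .ite_then h₁ (by simp) (.comp h₄ h₃)

theorem isEmpty {l : α → List β} (hl : PolyTime l) : PolyTime fun a => (l a).isEmpty :=
  (hl.lcase (const true) (const (α := α × (β × List β)) false)).of_enc_eq fun a => by
    cases l a <;> rfl

theorem tail {l : α → List β} (hl : PolyTime l) : PolyTime fun a => (l a).tail :=
  comp (g := List.tail) ⟨.right, _, polyBounded_esize.add (.const 1),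
    fun x => ⟨_, le_rfl, by
      cases x with
      | nil => exact Runs.right _
      | cons b x => exact Runs.right _⟩⟩ hl

theorem drop (m : ℕ) {l : α → List β} (hl : PolyTime l) : PolyTime fun a => (l a).drop m := by
  induction m with
  | zero => simpa using hl
  | succ m ih => exact ih.tail.of_enc_eq fun a => by rw [List.tail_drop]

theorem take (m : ℕ) {l : α → List β} (hl : PolyTime l) : PolyTime fun a => (l a).take m := by
  suffices h : PolyTime fun l : List β => l.take m from h.comp hl
  induction m with
  | zero => simpa using const (α := List β) ([] : List β)
  | succ m ih =>
    have h := id'.lcase (g := fun (_ : List β) (b : β) t => b :: t.take m)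
      (const (α := List β) ([] : List β))
      ((id'.snd.fst).cons (ih.comp id'.snd.snd))
    exact h.of_enc_eq fun l => by cases l <;> rfl

end PolyTime

/-- At most `N` rounds of a loop over a stack: as long as the stack is not empty, `step` is applied
to its top, its rest, and the remaining data. -/
def iter {β γ : Type} (step : (β × List β) × γ → List β × γ) : ℕ → List β × γ → List β × γ
  | 0, s => s
  | N + 1, (l, c) => lcase l (l, c) fun b t => iter step N (step ((b, t), c))

theorem iter_nil {β γ : Type} (step : (β × List β) × γ → List β × γ) (N : ℕ) (c : γ) :
    iter step N ([], c) = ([], c) := by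
  cases N <;> rfl

/-- A loop over a stack runs in polynomial time if it makes polynomially many rounds, each of them
takes polynomial time, and the data stay of polynomial size. -/
theorem PolyTime.iter {step : (β × List β) × γ → List β × γ} {s : α → List β × γ} {N : α → ℕ}
    (hstep : PolyTime step) (hs : PolyTime s) (hN : PolyBounded N)
    (hend : ∀ a, (iter step (N a) (s a)).1 = []) {B : α → ℕ} (hB : PolyBounded B)
    (hsize : ∀ a, ∀ j ≤ N a, esize (TwinCoverKernel.iter step j (s a)) ≤ B a) :
    PolyTime fun a => (TwinCoverKernel.iter step (N a) (s a)).2 := by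
  refine snd (f := fun a => TwinCoverKernel.iter step (N a) (s a)) ?_
  obtain ⟨q, U, ⟨P, hP⟩, hq⟩ := hstep
  have key : ∀ (N B : ℕ) (s : List β × γ), (TwinCoverKernel.iter step N s).1 = [] →
      (∀ j ≤ N, esize (TwinCoverKernel.iter step j s) ≤ B) →
      ∃ t ≤ (N + 1) * (P.eval B + B + 1),
        Runs (.loop q) (enc s) (enc (TwinCoverKernel.iter step N s)) t := by
    intro N B
    induction N with
    | zero =>
      rintro ⟨l, c⟩ hl hj
      have h0 := hj 0 le_rfl
      simp only [TwinCoverKernel.iter] at hl h0 ⊢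
      subst hl
      exact ⟨_, by simp only [esize] at h0; omega, Runs.loop_stop rfl⟩
    | succ N ih =>
      rintro ⟨l, c⟩ hl hj
      have h0 := hj 0 (by omega)
      cases l with
      | nil =>
        rw [iter_nil] at hl ⊢
        refine ⟨_, ?_, Runs.loop_stop rfl⟩
        rw [TwinCoverKernel.iter] at h0
        change esize (([] : List β), c) + 1 ≤ _
        nlinarith
      | cons b k =>
        simp only [TwinCoverKernel.iter, TwinCoverKernel.lcase] at hl ⊢
        obtain ⟨t, ht, hr⟩ := ih _ hl fun j hjN => by
          have := hj (j + 1) (by omega)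
          simpa only [TwinCoverKernel.iter, TwinCoverKernel.lcase] using this
        obtain ⟨u, hu, hr'⟩ := hq ((b, k), c)
        have hu' := (hu.trans (hP _)).trans (eval_mono P (n := B) h0)
        refine ⟨_, ?_, Runs.loop_step (by simp [Val.left]) hr' hr⟩
        change u + t + esize (b :: k, c) + 1 ≤ _
        rw [TwinCoverKernel.iter] at h0
        rw [add_one_mul (N + 1)]
        omega
  have h : ∀ a, ∃ t ≤ (N a + 1) * (P.eval (B a) + B a + 1),
      Runs (.loop q) (enc (s a)) (enc (TwinCoverKernel.iter step (N a) (s a))) t :=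
    fun a => key _ _ _ (hend a) (hsize a)
  have hb := hs.bounded
  obtain ⟨p, T, hT, hr⟩ := hs
  refine ⟨.comp (.loop q) p, _, (hT.add ((hN.add (.const 1)).mul
    (((PolyBounded.eval P hB).add hB).add (.const 1)))).add (.const 1), fun a => ?_⟩
  obtain ⟨t, ht, h₁⟩ := hr a
  obtain ⟨u, hu, h₂⟩ := h a
  exact ⟨t + u + 1, by omega, .comp h₁ h₂⟩

end

/-! ### List operations in polynomial time -/

section
variable {α β γ δ : Type} [Enc α] [Enc β] [Enc γ] [Enc δ]

theorem esize_drop_le (j : ℕ) (l : List α) : esize (l.drop j) ≤ esize l := by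
  have := esize_append (l.take j) (l.drop j)
  rw [List.take_append_drop] at this
  have := esize_pos (l.take j)
  omega

theorem iter_foldl {α β γ : Type} (f : α → γ → β → γ) (a : α) (j : ℕ) (l : List β) (c : γ) :
    iter (fun s : (β × List β) × (γ × α) => (s.1.2, (f s.2.2 s.2.1 s.1.1, s.2.2))) j (l, (c, a)) =
      (l.drop j, ((l.take j).foldl (f a) c, a)) := by
  induction j generalizing l c with
  | zero => simp [iter]
  | succ j ih => cases l <;> simp [iter, lcase, ih]

namespace PolyTime

/-- A fold runs in polynomial time if its accumulator stays of polynomial size. -/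
theorem foldl {l : α → List β} {c : α → γ} {f : α → γ → β → γ} (hl : PolyTime l) (hc : PolyTime c)
    (hf : PolyTime fun x : α × (γ × β) => f x.1 x.2.1 x.2.2) {B : α → ℕ} (hB : PolyBounded B)
    (h : ∀ a j, esize (((l a).take j).foldl (f a) (c a)) ≤ B a) :
    PolyTime fun a => (l a).foldl (f a) (c a) := by
  have hs := hl.mk (hc.mk id')
  have hstep : PolyTime fun s : (β × List β) × (γ × α) =>
      (s.1.2, (f s.2.2 s.2.1 s.1.1, s.2.2)) :=
    id'.fst.snd.mk ((hf.comp (id'.snd.snd.mk (id'.snd.fst.mk id'.fst.fst))).mk id'.snd.snd)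
  have := hstep.iter hs (N := fun a => (l a).length) (hl.bounded.of_le fun a => length_le_esize _)
    (fun a => by simp [iter_foldl])
    (((hl.bounded.add hB).add polyBounded_esize).add (.const 2)) (fun a j _ => by
      rw [iter_foldl, esize_mk, esize_mk]
      have h₁ := h a j
      have h₂ := esize_drop_le j (l a)
      omega)
  exact this.fst.of_enc_eq fun a => by rw [iter_foldl, List.take_length]

/-- A fold runs in polynomial time if each round adds polynomially much to the accumulator. -/
theorem foldl_of_add {l : α → List β} {c : α → γ} {f : α → γ → β → γ} (hl : PolyTime l)
    (hc : PolyTime c) (hf : PolyTime fun x : α × (γ × β) => f x.1 x.2.1 x.2.2) {Q : α → ℕ}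
    (hQ : PolyBounded Q) (h : ∀ a, ∀ b ∈ l a, ∀ c, esize (f a c b) ≤ esize c + Q a) :
    PolyTime fun a => (l a).foldl (f a) (c a) := by
  refine foldl hl hc hf (hc.bounded.add (hl.bounded.mul hQ)) fun a j => ?_
  have key : ∀ (k : List β) (c : γ), k ⊆ l a →
      esize (k.foldl (f a) c) ≤ esize c + k.length * Q a := by
    intro k
    induction k with
    | nil => simp
    | cons b k ih =>
      intro c hk
      rw [List.foldl_cons, List.length_cons, add_one_mul]
      have h₁ := ih (f a c b) fun x hx => hk (by simp [hx])
      have h₂ := h a b (hk (by simp)) c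
      omega
  refine (key _ _ (List.take_subset _ _)).trans ?_
  have h₁ := length_le_esize (l a)
  have h₂ : ((l a).take j).length ≤ (l a).length := List.length_take_le' _ _
  gcongr
  omega

theorem reverse {l : α → List β} (hl : PolyTime l) : PolyTime fun a => (l a).reverse := by
  have h := foldl_of_add (f := fun (_ : α) (c : List β) b => b :: c) hl (const ([] : List β))
    (id'.snd.snd.cons id'.snd.fst) (hl.bounded.add (.const 1)) (fun a b hb c => by
      have := esize_mem_le hb
      rw [esize_cons]
      omega)
  exact h.of_enc_eq fun a => by simp

theorem append {l m : α → List β} (hl : PolyTime l) (hm : PolyTime m) :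
    PolyTime fun a => l a ++ m a := by
  have h := foldl_of_add (f := fun (_ : α) (c : List β) b => b :: c) hl.reverse hm
    (id'.snd.snd.cons id'.snd.fst) (hl.bounded.add (.const 1)) (fun a b hb c => by
      have := esize_mem_le (List.mem_reverse.1 hb)
      rw [esize_cons]
      omega)
  exact h.of_enc_eq fun a => by simp

theorem bounded_of_mem {l : α → List β} {b : α × β → ℕ} (hl : PolyTime l) (hb : PolyBounded b) :
    ∃ c, PolyBounded c ∧ ∀ a, ∀ x ∈ l a, b (a, x) ≤ c a := by
  obtain ⟨P, hP⟩ := hb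
  refine ⟨_, PolyBounded.eval P ((polyBounded_esize.add hl.bounded).add (.const 1)),
    fun a x hx => (hP _).trans (eval_mono P ?_)⟩
  have := esize_mem_le hx
  rw [esize_mk]
  omega

theorem flatMap {l : α → List β} {f : α → β → List γ} (hl : PolyTime l)
    (hf : PolyTime fun x : α × β => f x.1 x.2) : PolyTime fun a => (l a).flatMap (f a) := by
  obtain ⟨Q, hQ, hQf⟩ := bounded_of_mem hl hf.bounded
  have h := foldl_of_add (f := fun a (c : List γ) b => (f a b).reverse ++ c) hl
    (const ([] : List γ)) ((hf.comp (id'.fst.mk id'.snd.snd)).reverse.append id'.snd.fst) hQ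
    (fun a b hb c => by
      have h₁ := hQf a b hb
      have h₂ := esize_append (f a b).reverse c
      rw [esize_reverse] at h₂
      simp only at h₁
      omega)
  refine h.reverse.of_enc_eq fun a => ?_
  congr 1
  suffices h : ∀ (k : List β) (c : List γ),
      (k.foldl (fun c b => (f a b).reverse ++ c) c).reverse = c.reverse ++ k.flatMap (f a) by
    simpa using h (l a) []
  intro k
  induction k with
  | nil => simp
  | cons b k ih => intro c; rw [List.foldl_cons, ih]; simp

theorem map {l : α → List β} {f : α → β → γ} (hl : PolyTime l)
    (hf : PolyTime fun x : α × β => f x.1 x.2) : PolyTime fun a => (l a).map (f a) :=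
  (hl.flatMap (f := fun a b => [f a b]) (hf.cons (const []))).of_enc_eq fun a => by
    rw [List.map_eq_flatMap]

theorem filter {l : α → List β} {p : α → β → Bool} (hl : PolyTime l)
    (hp : PolyTime fun x : α × β => p x.1 x.2) : PolyTime fun a => (l a).filter (p a) :=
  (hl.flatMap (f := fun a b => if p a b then [b] else [])
    (hp.ite (id'.snd.cons (const [])) (const []))).of_enc_eq fun a => by
      congr 1
      induction l a with
      | nil => rfl
      | cons b k ih => rw [List.flatMap_cons, ih, List.filter_cons]; split <;> rfl

theorem all {l : α → List β} {p : α → β → Bool} (hl : PolyTime l)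
    (hp : PolyTime fun x : α × β => p x.1 x.2) : PolyTime fun a => (l a).all (p a) :=
  (hl.filter (p := fun a b => !p a b) hp.not).isEmpty.of_enc_eq fun a => by
    congr 1
    rw [Bool.eq_iff_iff]
    simp [List.filter_eq_nil_iff]

theorem any {l : α → List β} {p : α → β → Bool} (hl : PolyTime l)
    (hp : PolyTime fun x : α × β => p x.1 x.2) : PolyTime fun a => (l a).any (p a) :=
  (hl.filter hp).isEmpty.not.of_enc_eq fun a => by
    congr 1
    rw [Bool.eq_iff_iff]
    simp [List.filter_eq_nil_iff]

end PolyTime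

/-! ### Equality in polynomial time -/

/-- A round of the comparison of pairs of trees on a stack. -/
def eqStep (s : ((Val × Val) × List (Val × Val)) × Bool) : List (Val × Val) × Bool :=
  if s.1.1.1.isNil then
    if s.1.1.2.isNil then (s.1.2, s.2) else ([], false)
  else if s.1.1.2.isNil then ([], false)
  else ((s.1.1.1.left, s.1.1.2.left) :: (s.1.1.1.right, s.1.1.2.right) :: s.1.2, s.2)

open PolyTime in
theorem polyTime_eqStep : PolyTime eqStep :=
  ite_isNil id'.fst.fst.fst (ite_isNil id'.fst.fst.snd (id'.fst.snd.mk id'.snd) (const _))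
    (ite_isNil id'.fst.fst.snd (const _)
      (((id'.fst.fst.fst.val_left.mk id'.fst.fst.snd.val_left).cons
        ((id'.fst.fst.fst.val_right.mk id'.fst.fst.snd.val_right).cons id'.fst.snd)).mk id'.snd))

theorem esize_iter_eqStep_le (j : ℕ) (s : List (Val × Val) × Bool) :
    esize (iter eqStep j s) ≤ esize s + 2 := by
  suffices h : ∀ l r, (esize (iter eqStep j (l, r)) ≤ esize (l, r) ∨
      esize (iter eqStep j (l, r)) ≤ 3) by
    have := esize_pos s
    rcases h s.1 s.2 with h | h
    · exact h.trans (Nat.le_add_right _ _)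
    · exact h.trans (by omega)
  induction j with
  | zero => intro l r; simp [iter]
  | succ j ih =>
    intro l r
    rcases l with _ | ⟨⟨x, y⟩, l⟩
    · simp [iter_nil]
    · simp only [iter, lcase]
      have e : esize (([] : List (Val × Val)), false) ≤ 3 := le_of_eq rfl
      rcases x with _ | ⟨x₁, x₂⟩ <;> rcases y with _ | ⟨y₁, y₂⟩ <;>
        simp only [eqStep, Val.isNil, if_true, Bool.false_eq_true, if_false, Val.left, Val.right,
          iter_nil]
      · have h₂ : esize (l, r) ≤ esize ((Val.nil, Val.nil) :: l, r) := by
          simp only [esize_mk, esize_cons]; omega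
        rcases ih l r with h | h
        · exact .inl (h.trans h₂)
        · exact .inr h
      · exact .inr e
      · exact .inr e
      · have h₂ : esize ((x₁, y₁) :: (x₂, y₂) :: l, r) ≤
            esize ((Val.node x₁ x₂, Val.node y₁ y₂) :: l, r) := by
          simp only [esize_mk, esize_cons]
          simp only [esize, enc, id, Val.size]
          omega
        rcases ih _ r with h | h
        · exact .inl (h.trans h₂)
        · exact .inr h

theorem iter_eqStep (N : ℕ) (l : List (Val × Val)) (r : Bool)
    (h : (l.map fun x => x.1.size).sum ≤ N) :
    (iter eqStep N (l, r)).1 = [] ∧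
      ((iter eqStep N (l, r)).2 = true ↔ r = true ∧ ∀ x ∈ l, x.1 = x.2) := by
  induction N generalizing l r with
  | zero =>
    rcases l with _ | ⟨⟨x, y⟩, l⟩
    · simp [iter]
    · have := x.size_pos
      simp at h
      omega
  | succ N ih =>
    rcases l with _ | ⟨⟨x, y⟩, l⟩
    · simp [iter_nil]
    · simp only [iter, lcase]
      rcases x with _ | ⟨x₁, x₂⟩ <;> rcases y with _ | ⟨y₁, y₂⟩ <;>
        simp only [eqStep, Val.isNil, if_true, Bool.false_eq_true, if_false, Val.left, Val.right,
          iter_nil]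
      · have := ih l r (by simp [Val.size] at h; omega)
        simpa using this
      · simp
      · simp
      · have := ih ((x₁, y₁) :: (x₂, y₂) :: l) r (by simp [Val.size] at h ⊢; omega)
        simpa [and_assoc] using this

namespace PolyTime

theorem eq [DecidableEq β] [LawfulEnc β] {f g : α → β} (hf : PolyTime f) (hg : PolyTime g) :
    PolyTime fun a => decide (f a = g a) := by
  have hf' : PolyTime fun a => enc (f a) := hf.of_enc_eq fun _ => rfl
  have hg' : PolyTime fun a => enc (g a) := hg.of_enc_eq fun _ => rfl
  have hs : PolyTime fun a => ([(enc (f a), enc (g a))], true) :=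
    ((hf'.mk hg').cons (const [])).mk (const true)
  have hi := fun a => iter_eqStep (esize (f a)) [(enc (f a), enc (g a))] true
    (by simp [esize])
  refine (polyTime_eqStep.iter hs hf.bounded (fun a => (hi a).1) (hs.bounded.add (.const 2))
    fun a j _ => esize_iter_eqStep_le j _).of_enc_eq fun a => ?_
  congr 1
  rw [Bool.eq_iff_iff, (hi a).2]
  simp [(LawfulEnc.inj (α := β)).eq_iff]

theorem mem [DecidableEq β] [LawfulEnc β] {f : α → β} {l : α → List β} (hf : PolyTime f) (hl : PolyTime l) :
    PolyTime fun a => decide (f a ∈ l a) :=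
  (hl.any (p := fun a b => decide (b = f a)) (id'.snd.eq (hf.comp id'.fst))).of_enc_eq fun a => by
    congr 1
    rw [Bool.eq_iff_iff]
    simp

end PolyTime

end

/-! ### Binary numbers -/

section
variable {α β γ δ : Type} [Enc α] [Enc β] [Enc γ] [Enc δ]

/-- Adds a carry bit to a number in binary, least significant digit first. -/
def addCarry : Bool → List Bool → List Bool
  | false, l => l
  | true, [] => [true]
  | true, false :: l => true :: l
  | true, true :: l => false :: addCarry true l

theorem bits_succ (n : ℕ) : Nat.bits (n + 1) = addCarry true (Nat.bits n) := by
  induction n using Nat.strong_induction_on with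
  | _ n ih =>
    obtain ⟨m, rfl | rfl⟩ := Nat.even_or_odd' n
    · rcases Nat.eq_zero_or_pos m with rfl | hm
      · simp [addCarry]
      · rw [Nat.bit1_bits, Nat.bit0_bits m (by omega), addCarry]
    · rw [Nat.bit1_bits, addCarry, ← ih m (by omega), ← Nat.bit0_bits (m + 1) (by omega)]
      congr 1

theorem foldl_addCarry (l : List Bool) (c : Bool) (o : List Bool) :
    (l.foldl (fun c b => (c.1 && b, (if c.1 then !b else b) :: c.2)) (c, o)).2.reverse ++
      (if (l.foldl (fun c b => (c.1 && b, (if c.1 then !b else b) :: c.2)) (c, o)).1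
        then [true] else []) = o.reverse ++ addCarry c l := by
  induction l generalizing c o with
  | nil => cases c <;> simp [addCarry]
  | cons b l ih =>
    rw [List.foldl_cons, ih]
    cases c <;> cases b <;> simp [addCarry]

theorem esize_succ_le (n : ℕ) : esize (n + 1) ≤ esize n + 4 := by
  change esize (Nat.bits (n + 1)) ≤ esize (Nat.bits n) + 4
  rw [bits_succ]
  induction Nat.bits n with
  | nil => simp [addCarry, esize, Val.size]
  | cons b l ih =>
    cases b
    · simp [addCarry, esize, Val.size]; omega
    · simp only [addCarry, esize_cons]
      have : esize false = 1 := rfl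
      have : esize true = 3 := rfl
      omega

theorem esize_nat_le (n : ℕ) : esize n ≤ 4 * n + 1 := by
  induction n with
  | zero => rfl
  | succ n ih => have := esize_succ_le n; omega

namespace PolyTime

theorem succ {f : α → ℕ} (hf : PolyTime f) : PolyTime fun a => f a + 1 := by
  suffices h : PolyTime fun n : ℕ => n + 1 from h.comp hf
  have hb : PolyTime fun n : ℕ => Nat.bits n := id'.of_enc_eq fun _ => rfl
  have h := foldl_of_add (f := fun (_ : ℕ) (c : Bool × List Bool) (b : Bool) =>
      (c.1 && b, (if c.1 then !b else b) :: c.2)) hb (const (true, []))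
      (((id'.snd.fst.fst).and id'.snd.snd).mk
        ((id'.snd.fst.fst.ite id'.snd.snd.not id'.snd.snd).cons id'.snd.fst.snd))
      (.const 8) (fun _ b _ c => by
        have h₁ := esize_bool_le (c.1 && b)
        have h₂ := esize_bool_le (if c.1 then !b else b)
        rw [esize_mk, esize_cons, esize_prod]
        omega)
  refine (h.snd.reverse.append (h.fst.ite (const [true]) (const []))).of_enc_eq fun n => ?_
  rw [foldl_addCarry, enc_nat (n + 1), bits_succ]
  rfl

theorem zipIdx {l : α → List β} (hl : PolyTime l) : PolyTime fun a => (l a).zipIdx := by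
  have key : ∀ (k : List β) (m : ℕ) (o : List (β × ℕ)),
      k.foldl (fun c b => ((b, c.2) :: c.1, c.2 + 1)) (o, m) =
        ((k.zipIdx m).reverse ++ o, m + k.length) := by
    intro k
    induction k with
    | nil => simp
    | cons b k ih =>
      intro m o
      rw [List.foldl_cons, ih]
      simp [List.zipIdx_cons, add_assoc, add_comm 1]
  have h := foldl (f := fun (_ : α) (c : List (β × ℕ) × ℕ) (b : β) =>
      ((b, c.2) :: c.1, c.2 + 1)) hl (const ([], 0))
      (((id'.snd.snd.mk id'.snd.fst.snd).cons id'.snd.fst.fst).mk id'.snd.fst.snd.succ)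
      (B := fun a => esize (l a) * (esize (l a) + (4 * esize (l a) + 1) + 1 + 1) + 1 +
        (4 * esize (l a) + 1) + 1)
      (((((hl.bounded.mul (((hl.bounded.add (((PolyBounded.const 4).mul hl.bounded).add
        (.const 1))).add (.const 1)).add (.const 1))).add (.const 1)).add
        (((PolyBounded.const 4).mul hl.bounded).add (.const 1))).add (.const 1)))
      (fun a j => by
        rw [key, esize_mk, List.append_nil, esize_reverse, zero_add]
        have h₀ := length_le_esize (l a)
        have h₁ : ((l a).take j).length ≤ esize (l a) :=
          (List.length_take_le' _ _).trans h₀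
        have h₂ := esize_nat_le ((l a).take j).length
        have h₃ : esize ((l a).take j).zipIdx ≤
            ((l a).take j).zipIdx.length * (esize (l a) + (4 * esize (l a) + 1) + 1 + 1) + 1 := by
          refine esize_list_le fun x hx => ?_
          have h₄ := esize_mem_le (List.take_subset _ _ (List.fst_mem_of_mem_zipIdx hx))
          have h₅ := List.snd_lt_of_mem_zipIdx hx
          have h₆ := esize_nat_le x.2
          rw [esize_prod]
          omega
        rw [List.length_zipIdx] at h₃
        have h₇ := Nat.mul_le_mul_right (esize (l a) + (4 * esize (l a) + 1) + 1 + 1) h₁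
        omega)
  exact h.fst.reverse.of_enc_eq fun a => by simp [key]

end PolyTime

/-! ### Reading and writing graphs -/

noncomputable instance : Enc FinGraph := ⟨fun G => Val.ofBits (encodeGraph G)⟩

theorem enc_bits (l : List Bool) : enc l = Val.ofBits l := by
  induction l with
  | nil => rfl
  | cons b l ih => cases b <;> simp [Val.ofBits, ih]

theorem size_ofBits_le (l : List Bool) : (Val.ofBits l).size ≤ 4 * l.length + 1 := by
  induction l with
  | nil => simp [Val.ofBits, Val.size]
  | cons b l ih => cases b <;> simp [Val.ofBits, Val.size] <;> omega

theorem PolyTime.computesInPolyTime {f : FinGraph → FinGraph} (hf : PolyTime f) :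
    ∃ p, ComputesInPolyTime p f := by
  obtain ⟨p, T, ⟨P, hP⟩, h⟩ := hf
  refine ⟨p, P.comp (4 * Polynomial.X + 1), fun G => ?_⟩
  obtain ⟨t, ht, hr⟩ := h G
  refine ⟨t, ht.trans ((hP G).trans ?_), hr⟩
  rw [Polynomial.eval_comp]
  refine eval_mono P ((size_ofBits_le (encodeGraph G)).trans ?_)
  simp

/-- The pairs of bits that make up the code of a number. -/
def natTokens (m : ℕ) : List (Bool × Bool) :=
  (Nat.bits m).map (fun b => (true, b)) ++ [(false, true)]

/-- The pairs of bits that make up the encoding of a graph. -/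
noncomputable def tokens (G : FinGraph) : List (Bool × Bool) :=
  (List.finRange G.n).flatMap fun v =>
    (neighborList G v).flatMap (fun u => natTokens u.val) ++ [(false, false)]

theorem encodeNat_eq (m : ℕ) : encodeNat m = (natTokens m).flatMap fun t => [t.1, t.2] := by
  simp [encodeNat, natTokens, List.flatMap_map]

theorem encodeGraph_eq (G : FinGraph) :
    encodeGraph G = (tokens G).flatMap fun t => [t.1, t.2] := by
  simp [encodeGraph, tokens, encodeNat_eq, List.flatMap_assoc]

theorem polyTime_tokens : PolyTime tokens := by
  have hb : PolyTime fun G : FinGraph => encodeGraph G := by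
    refine (PolyTime.id' (α := FinGraph)).of_enc_eq fun G => ?_
    rw [enc_bits]
    rfl
  have h := PolyTime.foldl_of_add (f := fun (_ : FinGraph) (c : List Bool × List (Bool × Bool))
      (b : Bool) => lcase c.1 ([b], c.2) fun x _ => ([], (x, b) :: c.2)) hb
      (.const ([], [])) (PolyTime.lcase PolyTime.id'.snd.fst.fst
        ((PolyTime.id'.snd.snd.cons (.const [])).mk PolyTime.id'.snd.fst.snd)
        ((PolyTime.const []).mk ((PolyTime.id'.snd.fst.mk PolyTime.id'.fst.snd.snd).cons
          PolyTime.id'.fst.snd.fst.snd)))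
      (.const 8) (fun _ b _ c => by
        have hb := esize_bool_le b
        rcases c with ⟨_ | ⟨x, l⟩, o⟩
        · simp only [lcase, esize_mk, esize_cons, esize_nil]
          omega
        · have := esize_pos l
          simp only [lcase, esize_mk, esize_cons, esize_nil]
          omega)
  refine h.snd.reverse.of_enc_eq fun G => ?_
  rw [encodeGraph_eq]
  congr 1
  suffices h : ∀ (k o : List (Bool × Bool)),
      (k.flatMap fun t => [t.1, t.2]).foldl (fun (c : List Bool × List (Bool × Bool)) b =>
        lcase c.1 ([b], c.2) fun x _ => ([], (x, b) :: c.2)) ([], o) = ([], k.reverse ++ o) by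
    simp [h]
  intro k
  induction k with
  | nil => simp
  | cons t k ih =>
    intro o
    rw [List.flatMap_cons, List.foldl_append, List.reverse_cons, List.append_assoc]
    exact ih (t :: o)

/-- The adjacency lists of a graph. -/
noncomputable def rows (G : FinGraph) : List (List ℕ) :=
  (List.finRange G.n).map fun v => (neighborList G v).map Fin.val

/-- A step of the parser: the state holds the digits of the current number, the neighbors of the
current vertex, and the adjacency lists of the previous vertices, all in reversed order. -/
def parseStep (c : List Bool × List (List Bool) × List (List (List Bool))) (t : Bool × Bool) :
    List Bool × List (List Bool) × List (List (List Bool)) :=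
  if t.1 then (t.2 :: c.1, c.2)
  else if t.2 then ([], c.1.reverse :: c.2.1, c.2.2)
  else ([], [], c.2.1.reverse :: c.2.2)

theorem foldl_parseStep_natTokens (m : ℕ) (k : List (List Bool))
    (r : List (List (List Bool))) :
    (natTokens m).foldl parseStep ([], k, r) = ([], Nat.bits m :: k, r) := by
  suffices h : ∀ (l o : List Bool), (l.map (fun b => (true, b))).foldl parseStep (o, k, r) =
      (l.reverse ++ o, k, r) by
    simp [natTokens, h, parseStep]
  intro l
  induction l with
  | nil => simp
  | cons b l ih => intro o; simp [ih, parseStep]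

theorem foldl_parseStep_flatMap {ι : Type*} (g : ι → ℕ) (l : List ι) (k : List (List Bool))
    (r : List (List (List Bool))) :
    (l.flatMap fun u => natTokens (g u)).foldl parseStep ([], k, r) =
      ([], (l.map fun u => Nat.bits (g u)).reverse ++ k, r) := by
  induction l generalizing k with
  | nil => simp
  | cons u l ih =>
    rw [List.flatMap_cons, List.foldl_append, foldl_parseStep_natTokens, ih]
    simp

theorem enc_map {g : α → β} (h : ∀ a, enc (g a) = enc a) (l : List α) :
    enc (l.map g) = enc l := by
  induction l with
  | nil => rfl
  | cons a l ih => simp [h, ih]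

theorem polyTime_rows : PolyTime rows := by
  have h := PolyTime.foldl_of_add (f := fun (_ : FinGraph) c t => parseStep c t) polyTime_tokens
      (.const ([], [], []))
      (PolyTime.ite PolyTime.id'.snd.snd.fst
        ((PolyTime.id'.snd.snd.snd.cons PolyTime.id'.snd.fst.fst).mk PolyTime.id'.snd.fst.snd)
        (PolyTime.ite PolyTime.id'.snd.snd.snd
          ((PolyTime.const []).mk ((PolyTime.id'.snd.fst.fst.reverse.cons
            PolyTime.id'.snd.fst.snd.fst).mk PolyTime.id'.snd.fst.snd.snd))
          ((PolyTime.const []).mk ((PolyTime.const []).mk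
            (PolyTime.id'.snd.fst.snd.fst.reverse.cons PolyTime.id'.snd.fst.snd.snd)))))
      (.const 8) (fun _ t _ c => by
        rcases c with ⟨c, k, r⟩
        rcases t with ⟨x, y⟩
        have := esize_bool_le y
        have := esize_pos c
        cases x <;> cases y <;> simp only [parseStep, esize_mk, esize_cons, esize_nil,
          esize_reverse, if_true, Bool.false_eq_true, if_false] <;> omega)
  refine h.snd.snd.reverse.of_enc_eq fun G => ?_
  have key : ∀ (l : List (Fin G.n)) (r : List (List (List Bool))),
      (l.flatMap fun v => (neighborList G v).flatMap (fun u => natTokens u.val) ++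
        [(false, false)]).foldl parseStep ([], [], r) =
      ([], [], (l.map fun v => (neighborList G v).map fun u => Nat.bits u.val).reverse ++ r) := by
    intro l
    induction l with
    | nil => simp
    | cons v l ih =>
      intro r
      rw [List.flatMap_cons, List.foldl_append, List.foldl_append, foldl_parseStep_flatMap]
      simp [parseStep, ih]
  have : (List.foldl (fun c t => parseStep c t) ([], [], []) (tokens G)).2.2.reverse =
      (rows G).map (List.map Nat.bits) := by
    rw [tokens]
    have := key (List.finRange G.n) []
    simp only [this]
    simp [rows, Function.comp_def]
  rw [this]
  exact enc_map (enc_map (g := Nat.bits) fun _ => rfl) _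

/-- The arcs of a graph: the pairs of adjacent vertices. -/
noncomputable def arcs (G : FinGraph) : List (ℕ × ℕ) :=
  (rows G).zipIdx.flatMap fun x => x.1.map fun u => (x.2, u)

theorem polyTime_arcs : PolyTime arcs :=
  polyTime_rows.zipIdx.flatMap (PolyTime.id'.snd.fst.map (PolyTime.id'.fst.snd.snd.mk
    PolyTime.id'.snd))

theorem mem_arcs {G : FinGraph} {u v : ℕ} :
    (u, v) ∈ arcs G ↔ ∃ (hu : u < G.n) (hv : v < G.n), G.graph.Adj ⟨u, hu⟩ ⟨v, hv⟩ := by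
  simp only [arcs, List.mem_flatMap, List.mem_map, Prod.mk.injEq, Prod.exists,
    List.mem_zipIdx_iff_getElem?]
  constructor
  · rintro ⟨l, i, hl, w, hw, rfl, rfl⟩
    obtain ⟨hi, rfl⟩ := List.getElem?_eq_some_iff.1 hl
    simp only [rows, List.length_map, List.length_finRange, List.getElem_map,
      List.getElem_finRange, List.mem_map, neighborList, List.mem_filter] at hi hw
    obtain ⟨x, ⟨-, hx⟩, rfl⟩ := hw
    exact ⟨hi, x.2, by simpa using hx⟩
  · rintro ⟨hu, hv, h⟩
    refine ⟨_, u, List.getElem?_eq_getElem (by simpa [rows] using hu), v, ?_, rfl, rfl⟩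
    simp only [rows, List.getElem_map, List.getElem_finRange, List.mem_map, neighborList,
      List.mem_filter]
    exact ⟨⟨v, hv⟩, ⟨List.mem_finRange _, by simpa using h⟩, rfl⟩

theorem polyTime_range : PolyTime fun G : FinGraph => List.range G.n :=
  (polyTime_rows.zipIdx.map (f := fun _ x => x.2) PolyTime.id'.snd.snd).of_enc_eq fun G => by
    congr 1
    rw [show (fun x : List ℕ × ℕ => x.2) = Prod.snd from rfl, List.zipIdx_map_snd]
    simp [rows, List.range_eq_range']

/-- The graph with a given list of vertices, renumbered by their positions in the list, and a given
adjacency relation. -/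
def graphOf (L : List ℕ) (r : ℕ → ℕ → Bool) (hs : ∀ u v, r u v = true → r v u = true)
    (hi : ∀ u, r u u = false) : FinGraph where
  n := L.length
  graph :=
    { Adj := fun i j => r L[i] L[j] = true
      symm := ⟨fun _ _ h => hs _ _ h⟩
      loopless := ⟨fun i h => by simp [hi] at h⟩ }

theorem encodeGraph_graphOf (L : List ℕ) (r : ℕ → ℕ → Bool) (hs hi) :
    encodeGraph (graphOf L r hs hi) = L.zipIdx.flatMap fun x =>
      (L.zipIdx.filter fun y => r x.1 y.1).flatMap (fun y => encodeNat y.2) ++ [false, false] := by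
  have hz : L.zipIdx = (List.finRange L.length).map fun i => (L[i], i.val) := by
    apply List.ext_getElem <;> simp
  rw [hz]
  simp only [encodeGraph, neighborList, List.flatMap_map, List.filter_map]
  refine congrArg₂ List.flatMap (funext fun i => ?_) rfl
  refine congrArg (fun l => List.flatMap _ l ++ [false, false]) (List.filter_congr fun j _ => ?_)
  exact @Bool.decide_eq_true (r L[i] L[j]) _

theorem polyTime_encodeNat {f : α → ℕ} (hf : PolyTime f) : PolyTime fun a => encodeNat (f a) := by
  have hb : PolyTime fun a => Nat.bits (f a) := hf.of_enc_eq fun _ => rfl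
  exact (hb.flatMap (f := fun _ b => [true, b]) ((PolyTime.const true).cons
    (PolyTime.id'.snd.cons (.const [])))).append (.const _)

theorem polyTime_graphOf {L : α → List ℕ} {r : α → ℕ → ℕ → Bool} (hs : ∀ a u v, r a u v = true → r a v u = true)
    (hi : ∀ a u, r a u u = false) (hL : PolyTime L)
    (hr : PolyTime fun x : α × (ℕ × ℕ) => r x.1 x.2.1 x.2.2) :
    PolyTime fun a => graphOf (L a) (r a) (hs a) (hi a) := by
  have h : PolyTime fun a => (L a).zipIdx.flatMap fun x =>
      ((L a).zipIdx.filter fun y => r a x.1 y.1).flatMap (fun y => encodeNat y.2) ++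
        [false, false] :=
    hL.zipIdx.flatMap ((PolyTime.flatMap
      ((hL.zipIdx.comp PolyTime.id'.fst).filter
        (hr.comp (PolyTime.id'.fst.fst.mk (PolyTime.id'.fst.snd.fst.mk PolyTime.id'.snd.fst))))
      (polyTime_encodeNat PolyTime.id'.snd.snd)).append (.const _))
  refine h.of_enc_eq fun a => ?_
  rw [← encodeGraph_graphOf _ _ (hs a) (hi a), enc_bits]
  rfl

end

/-! ### Gaussian elimination over the field with two elements -/

section
variable {κ ι : Type} [DecidableEq κ]

/-- The sum of two vectors over the field with two elements, where a vector is the list of its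
nonzero coordinates. -/
def xorList (a b : List κ) : List κ :=
  a.filter (fun k => !decide (k ∈ b)) ++ b.filter (fun k => !decide (k ∈ a))

/-- A round of the elimination: a nonzero vector is selected, and added to all the remaining vectors
that contain its first coordinate. -/
def elimStep (s : ((List κ × ι) × List (List κ × ι)) × List ι) : List (List κ × ι) × List ι :=
  lcase s.1.1.1 (s.1.2, s.2) fun p _ =>
    (s.1.2.map fun d => if decide (p ∈ d.1) then (xorList s.1.1.1 d.1, d.2) else d,
      s.1.1.2 :: s.2)

/-- The labels of a basis of the span of labelled vectors. -/
def selectBasis (L : List (List κ × ι)) : List ι :=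
  (iter elimStep L.length (L, [])).2

theorem mem_xorList {a b : List κ} {k : κ} :
    k ∈ xorList a b ↔ (k ∈ a ∧ k ∉ b) ∨ (k ∈ b ∧ k ∉ a) := by
  simp [xorList]

theorem nodup_xorList {a b : List κ} (ha : a.Nodup) (hb : b.Nodup) : (xorList a b).Nodup := by
  refine List.nodup_append.2 ⟨ha.filter _, hb.filter _, ?_⟩
  intro x hx y hy hxy
  simp at hx hy
  exact hx.2 (hxy ▸ hy.1)

theorem iter_elimStep_fst (N : ℕ) (L : List (List κ × ι)) (kept : List ι) (h : L.length ≤ N) :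
    (iter elimStep N (L, kept)).1 = [] := by
  induction N generalizing L kept with
  | zero => simpa [iter] using h
  | succ N ih =>
    rcases L with _ | ⟨⟨_ | ⟨p, w⟩, c⟩, L⟩
    · rw [iter_nil]
    · exact ih L kept (by simpa using h)
    · exact ih _ (c :: kept) (by simpa using h)

/-- What the elimination preserves, for vectors with coordinates in `U` and labels in `C`. -/
theorem iter_elimStep_invariant {U : List κ} {C : List ι} {n : ℕ} (j : ℕ) (L : List (List κ × ι))
    (kept : List ι) (hL : ∀ d ∈ L, d.1.Nodup ∧ d.1 ⊆ U ∧ d.2 ∈ C) (hk : kept ⊆ C)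
    (hn : L.length + kept.length ≤ n) :
    (∀ d ∈ (iter elimStep j (L, kept)).1, d.1.Nodup ∧ d.1 ⊆ U ∧ d.2 ∈ C) ∧
      (iter elimStep j (L, kept)).2 ⊆ C ∧
      (iter elimStep j (L, kept)).1.length + (iter elimStep j (L, kept)).2.length ≤ n := by
  induction j generalizing L kept with
  | zero => exact ⟨hL, hk, hn⟩
  | succ j ih =>
    rcases L with _ | ⟨⟨_ | ⟨p, w⟩, c⟩, L⟩
    · rw [iter_nil]
      exact ⟨by simp, hk, hn⟩
    · exact ih L kept (fun d hd => hL d (by simp [hd])) hk (by simp at hn; omega)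
    · obtain ⟨h₁, h₂, h₃⟩ := hL (p :: w, c) (by simp)
      refine ih _ (c :: kept) ?_ (List.cons_subset.2 ⟨h₃, hk⟩) (by simp at hn ⊢; omega)
      intro d hd
      obtain ⟨d, hm, rfl⟩ := List.mem_map.1 hd
      obtain ⟨h₄, h₅, h₆⟩ := hL d (List.mem_cons_of_mem _ hm)
      split_ifs
      · refine ⟨nodup_xorList h₁ h₄, fun k hk => ?_, h₆⟩
        rcases mem_xorList.1 hk with h | h
        · exact h₂ h.1
        · exact h₅ h.1
      · exact ⟨h₄, h₅, h₆⟩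

theorem selectBasis_subset (L : List (List κ × ι)) : selectBasis L ⊆ L.map Prod.snd := by
  suffices h : ∀ (j : ℕ) (L : List (List κ × ι)) (kept C : List ι), (∀ d ∈ L, d.2 ∈ C) →
      kept ⊆ C → (iter elimStep j (L, kept)).2 ⊆ C from
    h _ L [] _ (fun d hd => List.mem_map_of_mem hd) (by simp)
  intro j
  induction j with
  | zero => intro L kept C _ hk; exact hk
  | succ j ih =>
    intro L kept C hL hk
    rcases L with _ | ⟨⟨_ | ⟨p, w⟩, c⟩, L⟩
    · rwa [iter_nil]
    · exact ih L kept C (fun d hd => hL d (by simp [hd])) hk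
    · refine ih _ (c :: kept) C ?_ (List.cons_subset.2 ⟨hL (p :: w, c) (by simp), hk⟩)
      intro d hd
      obtain ⟨d, hm, rfl⟩ := List.mem_map.1 hd
      split_ifs <;> exact hL d (List.mem_cons_of_mem _ hm)

/-- The pivots of the selected vectors are different coordinates. -/
theorem length_selectBasis_le (L : List (List κ × ι)) (U : Finset κ)
    (h : ∀ d ∈ L, ∀ k ∈ d.1, k ∈ U) : (selectBasis L).length ≤ U.card := by
  suffices key : ∀ (j : ℕ) (L : List (List κ × ι)) (kept : List ι) (U : Finset κ),
      (∀ d ∈ L, ∀ k ∈ d.1, k ∈ U) →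
      (iter elimStep j (L, kept)).2.length ≤ kept.length + U.card by
    have := key L.length L [] U h
    rwa [List.length_nil, zero_add] at this
  intro j
  induction j with
  | zero => intro L kept U _; simp [iter]
  | succ j ih =>
    intro L kept U hL
    rcases L with _ | ⟨⟨_ | ⟨p, w⟩, c⟩, L⟩
    · rw [iter_nil]; simp
    · exact ih L kept U fun d hd => hL d (by simp [hd])
    · have hw := hL (p :: w, c) (by simp)
      have hp : p ∈ U := hw p (by simp)
      have := ih (L.map fun d => if decide (p ∈ d.1) then (xorList (p :: w) d.1, d.2) else d)
        (c :: kept) (U.erase p) (by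
          intro d hd k hk
          obtain ⟨d, hm, rfl⟩ := List.mem_map.1 hd
          have hd := hL d (List.mem_cons_of_mem _ hm)
          rw [Finset.mem_erase]
          split_ifs at hk with hpd
          · rw [decide_eq_true_eq] at hpd
            rcases mem_xorList.1 hk with h | h
            · exact ⟨fun e => h.2 (e ▸ hpd), hw k h.1⟩
            · exact ⟨fun e => h.2 (by simp [e]), hd k h.1⟩
          · rw [decide_eq_true_eq] at hpd
            exact ⟨fun e => hpd (e ▸ hk), hd k hk⟩)
      rw [Finset.card_erase_of_mem hp, List.length_cons] at this
      have hU := Finset.card_pos.2 ⟨p, hp⟩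
      refine this.trans ?_
      omega

/-- The value of a linear functional at a vector. -/
def evalFunctional (φ : κ → ZMod 2) (w : List κ) : ZMod 2 := ∑ k ∈ w.toFinset, φ k

theorem evalFunctional_xorList (φ : κ → ZMod 2) (a b : List κ) :
    evalFunctional φ (xorList a b) = evalFunctional φ a + evalFunctional φ b := by
  have h : (xorList a b).toFinset = (a.toFinset \ b.toFinset) ∪ (b.toFinset \ a.toFinset) := by
    ext k
    simp [mem_xorList]
  have hd : Disjoint (a.toFinset \ b.toFinset) (b.toFinset \ a.toFinset) :=
    Finset.disjoint_left.2 fun k h₁ h₂ => by simp at h₁ h₂; exact h₁.2 h₂.1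
  have h₁ := Finset.sum_inter_add_sum_sdiff a.toFinset b.toFinset φ
  have h₂ := Finset.sum_inter_add_sum_sdiff b.toFinset a.toFinset φ
  rw [Finset.inter_comm] at h₂
  unfold evalFunctional
  rw [h, Finset.sum_union hd, ← h₁, ← h₂]
  have := CharTwo.add_self_eq_zero (∑ k ∈ a.toFinset ∩ b.toFinset, φ k)
  linear_combination -this

/-- A linear functional that vanishes at the selected vectors vanishes at all vectors. -/
theorem evalFunctional_eq_zero_of_selectBasis (φ : κ → ZMod 2) (v : ι → List κ) (C : List ι)
    (h : ∀ c ∈ selectBasis (C.map fun c => (v c, c)), evalFunctional φ (v c) = 0) :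
    ∀ c ∈ C, evalFunctional φ (v c) = 0 := by
  suffices key : ∀ (j : ℕ) (L : List (List κ × ι)) (kept : List ι), L.length ≤ j →
      (∀ d ∈ L, evalFunctional φ d.1 = evalFunctional φ (v d.2)) →
      (∀ c ∈ (iter elimStep j (L, kept)).2, evalFunctional φ (v c) = 0) →
      (∀ c ∈ kept, evalFunctional φ (v c) = 0) ∧
      ∀ d ∈ L, evalFunctional φ (v d.2) = 0 by
    have := (key _ (C.map fun c => (v c, c)) [] le_rfl (by simp) h).2
    intro c hc
    exact this (v c, c) (List.mem_map_of_mem hc)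
  intro j
  induction j with
  | zero =>
    intro L kept hL _ hk
    simp only [Nat.le_zero, List.length_eq_zero_iff] at hL
    subst hL
    exact ⟨hk, by simp⟩
  | succ j ih =>
    intro L kept hlen hL hk
    rcases L with _ | ⟨⟨_ | ⟨p, w⟩, c⟩, L⟩
    · rw [iter_nil] at hk
      exact ⟨hk, by simp⟩
    · obtain ⟨h₁, h₂⟩ := ih L kept (by simpa using hlen) (fun d hd => hL d (by simp [hd])) hk
      refine ⟨h₁, fun d hd => ?_⟩
      rcases List.mem_cons.1 hd with rfl | hd
      · rw [← hL ([], c) (by simp)]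
        simp [evalFunctional]
      · exact h₂ d hd
    · have hkept : ∀ (j : ℕ) (L : List (List κ × ι)) (kept : List ι),
          kept ⊆ (iter elimStep j (L, kept)).2 := by
        intro j
        induction j with
        | zero => intro L kept; simp [iter]
        | succ j ih =>
          intro L kept
          rcases L with _ | ⟨⟨_ | ⟨p, w⟩, c⟩, L⟩
          · rw [iter_nil]; simp
          · exact ih L kept
          · exact fun x hx => ih _ (c :: kept) (List.mem_cons_of_mem c hx)
      have hc : evalFunctional φ (v c) = 0 := hk c (hkept j _ (c :: kept) (by simp))
      have hw : evalFunctional φ (p :: w) = 0 := (hL (p :: w, c) (by simp)).trans hc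
      obtain ⟨h₁, h₂⟩ := ih _ (c :: kept) (by simpa using hlen) (by
        intro d hd
        obtain ⟨d, hm, rfl⟩ := List.mem_map.1 hd
        have hd := hL d (List.mem_cons_of_mem _ hm)
        split_ifs
        · simp only
          rw [evalFunctional_xorList, hw, zero_add, hd]
        · exact hd) hk
      refine ⟨fun x hx => h₁ x (by simp [hx]), fun d hd => ?_⟩
      rcases List.mem_cons.1 hd with rfl | hd
      · exact hc
      · have := h₂ _ (List.mem_map_of_mem hd)
        split_ifs at this <;> exact this

end

theorem esize_eq_sum {κ : Type} [Enc κ] (l : List κ) : esize l = (l.map fun k => esize k + 1).sum + 1 := by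
  induction l with
  | nil => rfl
  | cons k l ih => rw [esize_cons, ih, List.map_cons, List.sum_cons]; omega

theorem esize_le_of_nodup_subset {κ : Type} [Enc κ] {w U : List κ} (hw : w.Nodup) (h : w ⊆ U) :
    esize w ≤ esize U := by
  obtain ⟨l, hl, hs⟩ := hw.subperm h
  rw [esize_eq_sum, esize_eq_sum U, ← (hl.map _).sum_eq]
  have := (hs.map fun k => esize k + 1).sum_le_sum (by simp)
  omega

section
variable {α κ ι : Type} [Enc α] [DecidableEq κ] [Enc κ] [LawfulEnc κ] [Enc ι]

theorem polyTime_xorList {a b : α → List κ} (ha : PolyTime a) (hb : PolyTime b) :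
    PolyTime fun x => xorList (a x) (b x) :=
  (ha.filter (PolyTime.id'.snd.mem (hb.comp PolyTime.id'.fst)).not).append
    (hb.filter (PolyTime.id'.snd.mem (ha.comp PolyTime.id'.fst)).not)

theorem polyTime_elimStep : PolyTime (elimStep : _ → List (List κ × ι) × List ι) := by
  unfold elimStep
  refine PolyTime.lcase PolyTime.id'.fst.fst.fst (PolyTime.id'.fst.snd.mk PolyTime.id'.snd) ?_
  refine (PolyTime.map PolyTime.id'.fst.fst.snd ?_).mk
    (PolyTime.id'.fst.fst.fst.snd.cons PolyTime.id'.fst.snd)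
  exact PolyTime.ite (PolyTime.id'.fst.snd.fst.mem PolyTime.id'.snd.fst)
    ((polyTime_xorList PolyTime.id'.fst.fst.fst.fst.fst PolyTime.id'.snd.fst).mk
      PolyTime.id'.snd.snd) PolyTime.id'.snd

theorem polyTime_selectBasis {L : α → List (List κ × ι)} (hL : PolyTime L)
    (hn : ∀ a, ∀ d ∈ L a, d.1.Nodup) : PolyTime fun a => selectBasis (L a) := by
  have hb := hL.bounded
  have hU : PolyTime fun a => (L a).flatMap Prod.fst :=
    hL.flatMap (f := fun _ d => d.1) PolyTime.id'.snd.fst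
  have hM := ((hU.bounded.add hb).add (.const 2))
  have hT := ((hb.mul hM).add (.const 1))
  refine polyTime_elimStep.iter (hL.mk (.const []))
    (hb.of_le fun a => length_le_esize _) (fun a => iter_elimStep_fst _ _ _ le_rfl)
    ((hT.add hT).add (.const 1)) fun a j _ => ?_
  obtain ⟨h₁, h₂, h₃⟩ := iter_elimStep_invariant (U := (L a).flatMap Prod.fst)
    (C := (L a).map Prod.snd) (n := (L a).length) j (L a) []
    (fun d hd => ⟨hn a d hd, fun k hk => List.mem_flatMap.2 ⟨d, hd, hk⟩, List.mem_map_of_mem hd⟩)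
    (by simp) (by simp)
  have hC : ∀ c ∈ (L a).map Prod.snd, esize c ≤ esize (L a) := by
    intro c hc
    obtain ⟨d, hd, rfl⟩ := List.mem_map.1 hc
    have := esize_mem_le hd
    rw [esize_prod] at this
    omega
  have hs := length_le_esize (L a)
  rw [esize_prod]
  refine Nat.add_le_add_right (add_le_add ?_ ?_) 1
  · refine (esize_list_le (M := esize ((L a).flatMap Prod.fst) + esize (L a) + 1) ?_).trans ?_
    · intro d hd
      obtain ⟨h₄, h₅, h₆⟩ := h₁ d hd
      have := esize_le_of_nodup_subset h₄ h₅
      have := hC _ h₆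
      rw [esize_prod]
      omega
    · gcongr
      omega
  · refine (esize_list_le (M := esize (L a)) fun c hc => hC c (h₂ hc)).trans ?_
    gcongr <;> omega

end

/-! ### The kernelization -/

/-- Adjacency, as a test on numbers. -/
noncomputable def adj (G : FinGraph) (u v : ℕ) : Bool := decide ((u, v) ∈ arcs G)

/-- Equality of closed neighborhoods, as a test on numbers. -/
noncomputable def twin (G : FinGraph) (u v : ℕ) : Bool :=
  (List.range G.n).all fun w =>
    decide ((decide (w = u) || adj G u w) = (decide (w = v) || adj G v w))

/-- The vertices that are among the first `D + 2` members of their twin class. A larger class cannot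
be colored by a graph of maximum degree `D`, and neither can `D + 2` of its members. -/
noncomputable def core (D : ℕ) (G : FinGraph) : List ℕ :=
  (List.range G.n).filter fun v =>
    decide (v ∈ ((List.range G.n).filter fun u => twin G v u).take (D + 2))

/-- The twin class of `v` within the core. -/
noncomputable def block (D : ℕ) (G : FinGraph) (v : ℕ) : List ℕ :=
  (core D G).filter fun u => twin G v u

/-- A step of the greedy computation of a twin-cover: if an edge between two vertices that are not
twins is not covered, the twin classes of both its ends are added. -/
noncomputable def coverStep (D : ℕ) (G : FinGraph) (X : List ℕ) (e : ℕ × ℕ) : List ℕ :=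
  if (!twin G e.1 e.2) && ((!decide (e.1 ∈ X)) && (!decide (e.2 ∈ X))) then
    (block D G e.1 ++ block D G e.2) ++ X
  else X

/-- The edges with both ends in the core. -/
noncomputable def coreArcs (D : ℕ) (G : FinGraph) : List (ℕ × ℕ) :=
  (arcs G).filter fun e => decide (e.1 ∈ core D G) && decide (e.2 ∈ core D G)

/-- A twin-cover of the core that is a union of twin classes. -/
noncomputable def cover (D : ℕ) (G : FinGraph) : List ℕ :=
  (coreArcs D G).foldl (coverStep D G) []

/-- The lists of at most `m` different elements of `X`. -/
def tuples : ℕ → List ℕ → List (List ℕ)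
  | 0, _ => [[]]
  | m + 1, X => [] :: X.flatMap fun x =>
      ((tuples m X).filter fun t => !decide (x ∈ t)).map fun t => x :: t

/-- The constraints: pairs of a twin class outside of the cover and a set of neighbors of this class
in the cover, with at most `D + 2` vertices in total. They stand for the requirement that the
coloring of the second set extends to the class. -/
noncomputable def constraints (D : ℕ) (G : FinGraph) : List (List ℕ × List ℕ) :=
  ((core D G).filter fun v => !decide (v ∈ cover D G)).flatMap fun v =>
    ((tuples (D + 1) ((cover D G).filter fun u => adj G v u)).filter fun S =>
      ((block D G v ++ S).drop (D + 2)).isEmpty).map fun S => (block D G v, S)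

/-- The vector over the field with two elements that is assigned to a constraint `(K, S)`. If `K`
is a single vertex and `S` has `D + 1` elements, it is the boundary of the simplex `S`. Otherwise it
is a unit vector, which determines `S` and the size of `K`. The coordinates of the two kinds are
kept apart by their first component, which is empty exactly for the faces of simplices. -/
def constraintVector (D : ℕ) (c : List ℕ × List ℕ) : List (List Unit × List ℕ) :=
  if (c.1.drop 1).isEmpty && !(c.2.drop D).isEmpty then
    c.2.map fun s => ([], c.2.filter fun t => !decide (t = s))
  else [(c.1.map fun _ => (), c.2)]

/-- The constraints that are kept: their vectors form a basis of the span of all vectors. -/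
noncomputable def keptConstraints (D : ℕ) (G : FinGraph) : List (List ℕ × List ℕ) :=
  selectBasis ((constraints D G).map fun c => (constraintVector D c, c))

/-- The vertices of the kernel: the cover and the classes of the kept constraints. -/
noncomputable def kernelVerts (D : ℕ) (G : FinGraph) : List ℕ :=
  (core D G).filter fun v =>
    decide (v ∈ cover D G) || (keptConstraints D G).any fun c => decide (v ∈ c.1)

/-- Some kept constraint `(K, S)` has `u` in `K` and a twin of `v` in `S`. -/
noncomputable def linked (D : ℕ) (G : FinGraph) (u v : ℕ) : Bool :=
  (keptConstraints D G).any fun c => decide (u ∈ c.1) && c.2.any fun s => twin G s v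

/-- The adjacency relation of the kernel: the edges of `G` that are inside the cover, between twins,
or required by a kept constraint. An edge to a vertex of `S` is accompanied by the edges to its
twins, so that twins of `G` remain twins. -/
noncomputable def kernelAdj (D : ℕ) (G : FinGraph) (u v : ℕ) : Bool :=
  adj G u v && ((decide (u ∈ cover D G) && decide (v ∈ cover D G)) ||
    (twin G u v || (linked D G u v || linked D G v u)))

theorem adj_iff {G : FinGraph} {u v : ℕ} : adj G u v = true ↔
    ∃ (hu : u < G.n) (hv : v < G.n), G.graph.Adj ⟨u, hu⟩ ⟨v, hv⟩ := by
  rw [adj, decide_eq_true_eq, mem_arcs]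

theorem adj_symm {G : FinGraph} {u v : ℕ} (h : adj G u v = true) : adj G v u = true := by
  obtain ⟨hu, hv, h⟩ := adj_iff.1 h
  exact adj_iff.2 ⟨hv, hu, h.symm⟩

theorem adj_ne {G : FinGraph} {u v : ℕ} (h : adj G u v = true) : u ≠ v := by
  rintro rfl
  obtain ⟨hu, hv, h⟩ := adj_iff.1 h
  exact h.ne rfl

theorem twin_iff {G : FinGraph} {u v : ℕ} : twin G u v = true ↔
    ∀ w < G.n, (w = u ∨ adj G u w = true) ↔ (w = v ∨ adj G v w = true) := by
  simp only [twin, List.all_eq_true, decide_eq_true_eq, List.mem_range]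
  refine forall₂_congr fun w _ => ?_
  rw [Bool.eq_iff_iff]
  simp

theorem twin_refl (G : FinGraph) (u : ℕ) : twin G u u = true := twin_iff.2 fun _ _ => Iff.rfl

theorem twin_symm {G : FinGraph} {u v : ℕ} (h : twin G u v = true) : twin G v u = true :=
  twin_iff.2 fun w hw => (twin_iff.1 h w hw).symm

theorem twin_trans {G : FinGraph} {u v w : ℕ} (h : twin G u v = true) (h' : twin G v w = true) :
    twin G u w = true :=
  twin_iff.2 fun x hx => (twin_iff.1 h x hx).trans (twin_iff.1 h' x hx)

theorem kernelAdj_symm (D : ℕ) (G : FinGraph) (u v : ℕ) (h : kernelAdj D G u v = true) :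
    kernelAdj D G v u = true := by
  simp only [kernelAdj, Bool.and_eq_true, Bool.or_eq_true] at h ⊢
  refine ⟨adj_symm h.1, ?_⟩
  rcases h.2 with h | h | h | h
  · exact .inl h.symm
  · exact .inr (.inl (twin_symm h))
  · exact .inr (.inr (.inr h))
  · exact .inr (.inr (.inl h))

theorem kernelAdj_irrefl (D : ℕ) (G : FinGraph) (u : ℕ) : kernelAdj D G u u = false := by
  rw [← Bool.not_eq_true]
  intro h
  simp only [kernelAdj, Bool.and_eq_true] at h
  exact adj_ne h.1 rfl

/-- The kernel. -/
noncomputable def kernel (D : ℕ) (G : FinGraph) : FinGraph :=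
  graphOf (kernelVerts D G) (kernelAdj D G) (kernelAdj_symm D G) (kernelAdj_irrefl D G)

theorem mem_tuples {m : ℕ} {X t : List ℕ} :
    t ∈ tuples m X ↔ t.length ≤ m ∧ t.Nodup ∧ t ⊆ X := by
  induction m generalizing t with
  | zero =>
    simp only [tuples, List.mem_singleton, Nat.le_zero, List.length_eq_zero_iff]
    constructor
    · rintro rfl; simp
    · exact fun h => h.1
  | succ m ih =>
    cases t with
    | nil => simp [tuples]
    | cons x t => simp [tuples, ih]; tauto

theorem length_tuples_le (m : ℕ) (X : List ℕ) : (tuples m X).length ≤ (X.length + 1) ^ m := by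
  induction m with
  | zero => simp [tuples]
  | succ m ih =>
    have h : ∀ Y : List ℕ, (Y.flatMap fun x =>
        ((tuples m X).filter fun t => !decide (x ∈ t)).map fun t => x :: t).length ≤
          Y.length * (X.length + 1) ^ m := by
      intro Y
      induction Y with
      | nil => simp
      | cons y Y ihY =>
        rw [List.flatMap_cons, List.length_append, List.length_map, List.length_cons, add_one_mul]
        have := (List.length_filter_le (fun t => !decide (y ∈ t)) (tuples m X)).trans ih
        omega
    have h₁ := h X
    have h₂ : 1 ≤ (X.length + 1) ^ m := Nat.one_le_pow _ _ (by omega)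
    rw [tuples, List.length_cons, pow_succ, mul_comm, add_one_mul]
    omega

theorem nodup_constraintVector (D : ℕ) {c : List ℕ × List ℕ} (h : c.2.Nodup) :
    (constraintVector D c).Nodup := by
  rw [constraintVector]
  split_ifs
  · refine h.map_on fun s hs t ht hst => ?_
    by_contra hne
    have : t ∈ c.2.filter fun x => !decide (x = s) := by simpa [ht] using Ne.symm hne
    rw [(Prod.mk.inj hst).2] at this
    simp at this
  · simp

/-! ### The kernelization runs in polynomial time -/

section
variable {α : Type} [Enc α] {G : α → FinGraph} {u v : α → ℕ}

theorem polyTime_adj (hG : PolyTime G) (hu : PolyTime u) (hv : PolyTime v) :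
    PolyTime fun a => adj (G a) (u a) (v a) :=
  ((hu.mk hv).mem (polyTime_arcs.comp hG)).of_enc_eq fun a => by
    congr 1
    simp [adj]

theorem polyTime_twin (hG : PolyTime G) (hu : PolyTime u) (hv : PolyTime v) :
    PolyTime fun a => twin (G a) (u a) (v a) := by
  have hG' : PolyTime fun x : α × ℕ => G x.1 := hG.comp PolyTime.id'.fst
  have hu' : PolyTime fun x : α × ℕ => u x.1 := hu.comp PolyTime.id'.fst
  have hv' : PolyTime fun x : α × ℕ => v x.1 := hv.comp PolyTime.id'.fst
  have hw : PolyTime fun x : α × ℕ => x.2 := PolyTime.id'.snd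
  exact (polyTime_range.comp hG).all
    (((hw.eq hu').or (polyTime_adj hG' hu' hw)).eq ((hw.eq hv').or (polyTime_adj hG' hv' hw)))

theorem polyTime_core (D : ℕ) : PolyTime (core D) := by
  have hv : PolyTime fun x : FinGraph × ℕ => x.2 := PolyTime.id'.snd
  refine polyTime_range.filter (hv.mem (PolyTime.take _ ?_))
  exact (polyTime_range.comp PolyTime.id'.fst).filter
    (polyTime_twin PolyTime.id'.fst.fst PolyTime.id'.fst.snd PolyTime.id'.snd)

theorem polyTime_block (D : ℕ) (hG : PolyTime G) (hv : PolyTime v) :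
    PolyTime fun a => block D (G a) (v a) :=
  ((polyTime_core D).comp hG).filter
    (polyTime_twin (hG.comp PolyTime.id'.fst) (hv.comp PolyTime.id'.fst) PolyTime.id'.snd)

theorem polyTime_coreArcs (D : ℕ) : PolyTime (coreArcs D) := by
  have hc : PolyTime fun x : FinGraph × (ℕ × ℕ) => core D x.1 :=
    (polyTime_core D).comp PolyTime.id'.fst
  exact polyTime_arcs.filter ((PolyTime.id'.snd.fst.mem hc).and (PolyTime.id'.snd.snd.mem hc))

theorem esize_filter_le {β : Type} [Enc β] (p : β → Bool) (l : List β) :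
    esize (l.filter p) ≤ esize l := by
  induction l with
  | nil => simp
  | cons b l ih =>
    rw [List.filter_cons]
    split
    · rw [esize_cons, esize_cons]; omega
    · rw [esize_cons]; omega

theorem polyTime_cover (D : ℕ) : PolyTime (cover D) := by
  have hG : PolyTime fun x : FinGraph × (List ℕ × (ℕ × ℕ)) => x.1 := PolyTime.id'.fst
  have hX : PolyTime fun x : FinGraph × (List ℕ × (ℕ × ℕ)) => x.2.1 := PolyTime.id'.snd.fst
  have hu : PolyTime fun x : FinGraph × (List ℕ × (ℕ × ℕ)) => x.2.2.1 := PolyTime.id'.snd.snd.fst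
  have hv : PolyTime fun x : FinGraph × (List ℕ × (ℕ × ℕ)) => x.2.2.2 := PolyTime.id'.snd.snd.snd
  refine (polyTime_coreArcs D).foldl_of_add (.const [])
    (PolyTime.ite ((polyTime_twin hG hu hv).not.and ((hu.mem hX).not.and (hv.mem hX).not))
      (((polyTime_block D hG hu).append (polyTime_block D hG hv)).append hX) hX)
    ((polyTime_core D).bounded.add (polyTime_core D).bounded) fun G e _ X => ?_
  rw [coverStep]
  split_ifs
  · have h₁ := esize_append (block D G e.1 ++ block D G e.2) X
    have h₂ := esize_append (block D G e.1) (block D G e.2)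
    have h₃ : esize (block D G e.1) ≤ esize (core D G) := esize_filter_le _ _
    have h₄ : esize (block D G e.2) ≤ esize (core D G) := esize_filter_le _ _
    omega
  · omega

theorem polyTime_tuples (m : ℕ) : PolyTime (tuples m) := by
  induction m with
  | zero => exact .const _
  | succ m ih =>
    refine (PolyTime.const []).cons (PolyTime.id'.flatMap ?_)
    refine PolyTime.map ((ih.comp PolyTime.id'.fst).filter ?_)
      (PolyTime.id'.fst.snd.cons PolyTime.id'.snd)
    exact (PolyTime.id'.fst.snd.mem PolyTime.id'.snd).not

theorem polyTime_constraints (D : ℕ) : PolyTime (constraints D) := by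
  refine ((polyTime_core D).filter
    (PolyTime.id'.snd.mem ((polyTime_cover D).comp PolyTime.id'.fst)).not).flatMap ?_
  refine PolyTime.map (PolyTime.filter ((polyTime_tuples _).comp
    (((polyTime_cover D).comp PolyTime.id'.fst).filter
      (polyTime_adj PolyTime.id'.fst.fst PolyTime.id'.fst.snd PolyTime.id'.snd))) ?_)
    ((polyTime_block D PolyTime.id'.fst.fst PolyTime.id'.fst.snd).mk PolyTime.id'.snd)
  exact (PolyTime.drop _ ((polyTime_block D PolyTime.id'.fst.fst PolyTime.id'.fst.snd).append
    PolyTime.id'.snd)).isEmpty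

theorem polyTime_constraintVector (D : ℕ) : PolyTime (constraintVector D) := by
  refine PolyTime.ite ((PolyTime.id'.fst.drop 1).isEmpty.and (PolyTime.id'.snd.drop D).isEmpty.not)
    (PolyTime.id'.snd.map ((PolyTime.const []).mk (PolyTime.id'.fst.snd.filter
      (PolyTime.id'.snd.eq PolyTime.id'.fst.snd).not)))
    (((PolyTime.id'.fst.map (.const ())).mk PolyTime.id'.snd).cons (.const []))

theorem polyTime_keptConstraints (D : ℕ) : PolyTime (keptConstraints D) := by
  refine polyTime_selectBasis ((polyTime_constraints D).map
    (((polyTime_constraintVector D).comp PolyTime.id'.snd).mk PolyTime.id'.snd)) fun G d hd => ?_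
  obtain ⟨c, hc, rfl⟩ := List.mem_map.1 hd
  refine nodup_constraintVector D ?_
  simp only [constraints, List.mem_flatMap, List.mem_map, List.mem_filter, mem_tuples] at hc
  obtain ⟨v, -, S, ⟨⟨-, hS, -⟩, -⟩, rfl⟩ := hc
  exact hS

theorem polyTime_kernelVerts (D : ℕ) : PolyTime (kernelVerts D) := by
  refine (polyTime_core D).filter
    ((PolyTime.id'.snd.mem ((polyTime_cover D).comp PolyTime.id'.fst)).or
      (PolyTime.any ((polyTime_keptConstraints D).comp PolyTime.id'.fst) ?_))
  exact PolyTime.id'.fst.snd.mem PolyTime.id'.snd.fst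

theorem polyTime_linked (D : ℕ) (hG : PolyTime G) (hu : PolyTime u) (hv : PolyTime v) :
    PolyTime fun a => linked D (G a) (u a) (v a) := by
  refine ((polyTime_keptConstraints D).comp hG).any
    (((hu.comp PolyTime.id'.fst).mem PolyTime.id'.snd.fst).and (PolyTime.id'.snd.snd.any ?_))
  exact polyTime_twin (hG.comp PolyTime.id'.fst.fst) PolyTime.id'.snd
    (hv.comp PolyTime.id'.fst.fst)

theorem polyTime_kernel (D : ℕ) : PolyTime (kernel D) := by
  refine polyTime_graphOf (r := kernelAdj D) (kernelAdj_symm D) (kernelAdj_irrefl D)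
    (polyTime_kernelVerts D) ?_
  have hG : PolyTime fun x : FinGraph × (ℕ × ℕ) => x.1 := PolyTime.id'.fst
  have hu : PolyTime fun x : FinGraph × (ℕ × ℕ) => x.2.1 := PolyTime.id'.snd.fst
  have hv : PolyTime fun x : FinGraph × (ℕ × ℕ) => x.2.2 := PolyTime.id'.snd.snd
  have hX := (polyTime_cover D).comp hG
  exact (polyTime_adj hG hu hv).and (((hu.mem hX).and (hv.mem hX)).or
    ((polyTime_twin hG hu hv).or ((polyTime_linked D hG hu hv).or (polyTime_linked D hG hv hu))))

end

/-! ### Twin classes, the cover and the constraints -/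

section
variable {D : ℕ} {G : FinGraph} {u v w : ℕ}

theorem twin_iff_twins (hu : u < G.n) (hv : v < G.n) :
    twin G u v = true ↔ Twins G.graph ⟨u, hu⟩ ⟨v, hv⟩ := by
  rw [twin_iff, Twins, Set.ext_iff]
  simp only [Set.mem_insert_iff, SimpleGraph.mem_neighborSet, adj_iff]
  constructor
  · intro h x
    simpa [hu, hv, Fin.ext_iff] using h x.1 x.2
  · intro h w hw
    simpa [hu, hv, hw, Fin.ext_iff] using h ⟨w, hw⟩

theorem adj_of_twin (hv : v < G.n) (h : twin G u v = true) (hne : u ≠ v) : adj G u v = true :=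
  ((twin_iff.1 h v hv).2 (.inl rfl)).resolve_left hne.symm

theorem adj_congr_twin (hw : w < G.n) (h : twin G u v = true) (hu : w ≠ u) (hv : w ≠ v) :
    adj G u w = true ↔ adj G v w = true := by
  simpa [hu, hv] using twin_iff.1 h w hw

theorem twin_congr (h : twin G u v = true) (w : ℕ) : twin G u w = twin G v w := by
  rw [Bool.eq_iff_iff]
  exact ⟨twin_trans (twin_symm h), twin_trans h⟩

theorem lt_of_mem_core (h : v ∈ core D G) : v < G.n := by
  simpa using (List.mem_filter.1 h).1

theorem lt_of_adj (h : adj G u v = true) : v < G.n := (adj_iff.1 h).2.1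

theorem nodup_core : (core D G).Nodup := List.nodup_range.filter _

theorem mem_block : u ∈ block D G v ↔ u ∈ core D G ∧ twin G v u = true := by
  simp [block]

theorem nodup_block : (block D G v).Nodup := nodup_core.filter _

theorem block_congr (h : twin G u v = true) : block D G u = block D G v :=
  List.filter_congr fun w _ => twin_congr h w

theorem mem_block_self (h : v ∈ core D G) : v ∈ block D G v := mem_block.2 ⟨h, twin_refl G v⟩

theorem length_block_le : (block D G v).length ≤ D + 2 := by
  have h : block D G v ⊆ ((List.range G.n).filter fun u => twin G v u).take (D + 2) := by
    intro u hu
    obtain ⟨hu, ht⟩ := mem_block.1 hu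
    have := (List.mem_filter.1 hu).2
    rw [decide_eq_true_eq] at this
    rwa [List.filter_congr fun w _ => twin_congr ht w]
  exact (nodup_block.subperm h).length_le.trans (List.length_take_le _ _)

/-- A twin class that loses members still has `D + 2` of them. -/
theorem exists_length_block (hv : v < G.n) (h : v ∉ core D G) :
    ∃ u ∈ core D G, (block D G u).length = D + 2 := by
  set C := (List.range G.n).filter fun u => twin G v u with hC
  have hvC : v ∈ C := by simp [hC, hv, twin_refl]
  have hlen : D + 2 < C.length := by
    by_contra hle
    apply h
    rw [core, List.mem_filter]
    refine ⟨by simpa using hv, ?_⟩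
    rw [decide_eq_true_eq, List.take_of_length_le (not_lt.1 hle)]
    exact hvC
  have hsub : ∀ x ∈ C.take (D + 2), x ∈ core D G ∧ twin G v x = true := by
    intro x hx
    have hxC := List.take_subset _ _ hx
    have ht : twin G v x = true := (List.mem_filter.1 hxC).2
    refine ⟨List.mem_filter.2 ⟨(List.mem_filter.1 hxC).1, ?_⟩, ht⟩
    rwa [decide_eq_true_eq, List.filter_congr fun w _ => (twin_congr ht w).symm]
  have hne : C.take (D + 2) ≠ [] := by
    rw [← List.length_pos_iff, List.length_take]
    omega
  obtain ⟨u, hu⟩ := List.exists_mem_of_ne_nil _ hne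
  obtain ⟨huc, hut⟩ := hsub u hu
  refine ⟨u, huc, le_antisymm length_block_le ?_⟩
  have h₁ : C.take (D + 2) ⊆ block D G u := fun x hx => by
    obtain ⟨h₁, h₂⟩ := hsub x hx
    exact mem_block.2 ⟨h₁, twin_trans (twin_symm hut) h₂⟩
  have h₂ : (C.take (D + 2)).Nodup := (List.nodup_range.filter _).sublist (List.take_sublist _ _)
  have := (h₂.subperm h₁).length_le
  rw [List.length_take] at this
  omega

theorem subset_coverStep (X : List ℕ) (e : ℕ × ℕ) : X ⊆ coverStep D G X e := by
  intro x hx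
  rw [coverStep]
  split_ifs
  · exact List.mem_append_right _ hx
  · exact hx

theorem subset_foldl_coverStep (l : List (ℕ × ℕ)) (X : List ℕ) :
    X ⊆ l.foldl (coverStep D G) X := by
  induction l generalizing X with
  | nil => simp
  | cons e l ih => exact fun x hx => ih _ (subset_coverStep X e hx)

/-- A property of the greedy cover that holds at the start and is preserved by each step. -/
theorem cover_induction {P : List ℕ → Prop} (h0 : P [])
    (h : ∀ X, P X → ∀ u v, u ∈ core D G → v ∈ core D G → adj G u v = true →
      ¬ twin G u v = true → u ∉ X → v ∉ X → P (block D G u ++ block D G v ++ X)) :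
    P (cover D G) := by
  suffices key : ∀ l ⊆ coreArcs D G, ∀ X, P X → P (l.foldl (coverStep D G) X) from
    key _ (fun _ hx => hx) [] h0
  intro l
  induction l with
  | nil => exact fun _ X hX => hX
  | cons e l ih =>
    intro hl X hX
    refine ih (fun x hx => hl (by simp [hx])) _ ?_
    rw [coverStep]
    split_ifs with hc
    · have he := hl (List.mem_cons_self (a := e) (l := l))
      simp only [coreArcs, List.mem_filter, Bool.and_eq_true, decide_eq_true_eq] at he
      simp only [Bool.and_eq_true, Bool.not_eq_true', decide_eq_false_iff_not] at hc
      exact h X hX e.1 e.2 he.2.1 he.2.2 (decide_eq_true he.1) (by simp [hc.1]) hc.2.1 hc.2.2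
    · exact hX

theorem mem_core_of_mem_cover (h : v ∈ cover D G) : v ∈ core D G := by
  suffices key : ∀ v, v ∈ cover D G → v ∈ core D G from key v h
  refine cover_induction (P := fun X => ∀ v, v ∈ X → v ∈ core D G) (by simp) ?_
  intro X hX u v _ _ _ _ _ _ w hw
  rw [List.mem_append, List.mem_append] at hw
  rcases hw with (hw | hw) | hw
  · exact (mem_block.1 hw).1
  · exact (mem_block.1 hw).1
  · exact hX w hw

theorem mem_cover_of_twin (hu : u ∈ cover D G) (hv : v ∈ core D G) (h : twin G u v = true) :
    v ∈ cover D G := by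
  revert hu
  refine cover_induction (P := fun X => u ∈ X → v ∈ X) (by simp) ?_
  intro X hX x y _ _ _ _ _ _ hu
  rw [List.mem_append, List.mem_append] at hu ⊢
  rcases hu with (hu | hu) | hu
  · exact .inl (.inl (mem_block.2 ⟨hv, twin_trans (mem_block.1 hu).2 h⟩))
  · exact .inl (.inr (mem_block.2 ⟨hv, twin_trans (mem_block.1 hu).2 h⟩))
  · exact .inr (hX hu)

theorem mem_cover_or_of_adj (hu : u ∈ core D G) (hv : v ∈ core D G) (h : adj G u v = true)
    (ht : ¬ twin G u v = true) : u ∈ cover D G ∨ v ∈ cover D G := by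
  have he : (u, v) ∈ coreArcs D G := by
    simp only [coreArcs, List.mem_filter, Bool.and_eq_true, decide_eq_true_eq]
    exact ⟨of_decide_eq_true h, hu, hv⟩
  obtain ⟨l₁, l₂, hl⟩ := List.append_of_mem he
  rw [cover, hl, List.foldl_append, List.foldl_cons]
  set X := l₁.foldl (coverStep D G) []
  suffices h : u ∈ coverStep D G X (u, v) ∨ v ∈ coverStep D G X (u, v) from
    h.imp (fun h => subset_foldl_coverStep _ _ h) (fun h => subset_foldl_coverStep _ _ h)
  rw [coverStep]
  split_ifs with hc
  · exact .inl (List.mem_append_left _ (List.mem_append_left _ (mem_block_self hu)))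
  · by_contra hne
    push Not at hne
    exact hc (by simp [ht, hne.1, hne.2])

/-- Every twin-cover has a vertex in each pair of classes that the greedy algorithm adds. -/
theorem length_cover_le {Y : Finset ℕ} (hY : ∀ u v, adj G u v = true → ¬ twin G u v = true →
    u ∈ Y ∨ v ∈ Y) : (cover D G).length ≤ 2 * (D + 2) * Y.card := by
  suffices h : (cover D G).length ≤ 2 * (D + 2) * (Y.filter (· ∈ cover D G)).card by
    refine h.trans ?_
    gcongr
    exact Finset.filter_subset _ _
  refine cover_induction (P := fun X => X.length ≤ 2 * (D + 2) * (Y.filter (· ∈ X)).card)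
    (by simp) ?_
  intro X hX u v hu hv ha ht huX hvX
  have hlt : (Y.filter (· ∈ X)).card <
      (Y.filter (· ∈ block D G u ++ block D G v ++ X)).card := by
    apply Finset.card_lt_card
    rw [Finset.ssubset_iff_of_subset]
    · rcases hY u v ha ht with h | h
      · exact ⟨u, by simp [h, mem_block_self hu], by simp [huX]⟩
      · exact ⟨v, by simp [h, mem_block_self hv], by simp [hvX]⟩
    · intro x hx
      rw [Finset.mem_filter] at hx ⊢
      exact ⟨hx.1, List.mem_append_right _ hx.2⟩
  have h₁ := length_block_le (D := D) (G := G) (v := u)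
  have h₂ := length_block_le (D := D) (G := G) (v := v)
  rw [List.length_append, List.length_append]
  have h₃ := Nat.mul_le_mul_left (2 * (D + 2)) (Nat.succ_le_of_lt hlt)
  rw [Nat.succ_eq_add_one, mul_add, mul_one] at h₃
  omega

theorem mem_constraints {c : List ℕ × List ℕ} : c ∈ constraints D G ↔
    ∃ v ∈ core D G, v ∉ cover D G ∧ c.1 = block D G v ∧ c.2.Nodup ∧
      (∀ s ∈ c.2, s ∈ cover D G ∧ adj G v s = true) ∧ c.1.length + c.2.length ≤ D + 2 := by
  obtain ⟨K, S⟩ := c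
  simp only [constraints, List.mem_flatMap, List.mem_map, List.mem_filter, mem_tuples,
    List.isEmpty_iff, List.drop_eq_nil_iff, List.length_append, Bool.not_eq_true',
    decide_eq_false_iff_not, List.subset_def, Prod.mk.injEq]
  constructor
  · rintro ⟨v, ⟨hv, hX⟩, S, ⟨⟨-, hS, hN⟩, hlen⟩, rfl, rfl⟩
    exact ⟨v, hv, hX, rfl, hS, fun s hs => hN hs, hlen⟩
  · rintro ⟨v, hv, hX, rfl, hS, hN, hlen⟩
    have := List.length_pos_of_mem (mem_block_self hv)
    exact ⟨v, ⟨hv, hX⟩, S, ⟨⟨by omega, hS, fun {s} hs => hN s hs⟩, hlen⟩, rfl, rfl⟩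

theorem mem_constraints_of_kept {c : List ℕ × List ℕ} (h : c ∈ keptConstraints D G) :
    c ∈ constraints D G := by
  have := selectBasis_subset _ h
  simpa using this

theorem mem_kernelVerts : v ∈ kernelVerts D G ↔
    v ∈ core D G ∧ (v ∈ cover D G ∨ ∃ c ∈ keptConstraints D G, v ∈ c.1) := by
  simp [kernelVerts]

theorem linked_iff : linked D G u v = true ↔
    ∃ c ∈ keptConstraints D G, u ∈ c.1 ∧ ∃ s ∈ c.2, twin G s v = true := by
  simp [linked]

theorem kernelAdj_iff : kernelAdj D G u v = true ↔ adj G u v = true ∧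
    ((u ∈ cover D G ∧ v ∈ cover D G) ∨ twin G u v = true ∨ linked D G u v = true ∨
      linked D G v u = true) := by
  simp [kernelAdj]

theorem linked_congr_left (hv : v ∈ core D G) (h : twin G u v = true)
    (hl : linked D G u w = true) : linked D G v w = true := by
  rw [linked_iff] at hl ⊢
  obtain ⟨c, hc, hu, hs⟩ := hl
  refine ⟨c, hc, ?_, hs⟩
  obtain ⟨z, -, -, hz, -⟩ := mem_constraints.1 (mem_constraints_of_kept hc)
  rw [hz] at hu ⊢
  exact mem_block.2 ⟨hv, twin_trans (mem_block.1 hu).2 h⟩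

theorem linked_congr_right (h : twin G u v = true) (hl : linked D G w u = true) :
    linked D G w v = true := by
  rw [linked_iff] at hl ⊢
  obtain ⟨c, hc, hu, s, hs, hsu⟩ := hl
  exact ⟨c, hc, hu, s, hs, twin_trans hsu h⟩

/-- Twins of `G` remain twins in the kernel. -/
theorem kernelAdj_of_twin (hu : u ∈ core D G) (hv : v ∈ core D G)
    (h : twin G u v = true) (hw : w = u ∨ kernelAdj D G u w = true) :
    w = v ∨ kernelAdj D G v w = true := by
  by_cases hwv : w = v
  · exact .inl hwv
  right
  rcases hw with rfl | hw
  · rw [kernelAdj_iff]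
    exact ⟨adj_of_twin (lt_of_mem_core hu) (twin_symm h) (Ne.symm hwv), .inr (.inl (twin_symm h))⟩
  · rw [kernelAdj_iff] at hw ⊢
    have hwn : w ≠ u := (adj_ne hw.1).symm
    refine ⟨(adj_congr_twin (lt_of_adj hw.1) h hwn hwv).1 hw.1, ?_⟩
    rcases hw.2 with hc | hc | hc | hc
    · exact .inl ⟨mem_cover_of_twin hc.1 hv h, hc.2⟩
    · exact .inr (.inl (twin_trans (twin_symm h) hc))
    · exact .inr (.inr (.inl (linked_congr_left hv h hc)))
    · exact .inr (.inr (.inr (linked_congr_right h hc)))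

theorem nodup_kernelVerts : (kernelVerts D G).Nodup := nodup_core.filter _

end

/-! ### The kernel is a subgraph and inherits twin-covers -/

theorem hasTwinCover_kernel {D k : ℕ} {G : FinGraph} (h : HasTwinCover G k) :
    HasTwinCover (kernel D G) k := by
  obtain ⟨Y, hk, hY⟩ := h
  set L := kernelVerts D G with hL
  have hLc : ∀ i : Fin L.length, L[i] ∈ core D G := fun i =>
    (mem_kernelVerts.1 (List.getElem_mem i.2)).1
  have hLn : ∀ i : Fin L.length, L[i] < G.n := fun i => lt_of_mem_core (hLc i)
  have hinj : ∀ i j : Fin L.length, L[i] = L[j] → i = j := fun i j hij =>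
    Fin.ext ((nodup_kernelVerts.getElem_inj_iff).1 hij)
  let f : Fin L.length → Fin G.n := fun i => ⟨L[i], hLn i⟩
  have hf : Function.Injective f := fun i j hij => hinj i j (Fin.mk.inj hij)
  classical
  refine ⟨(Finset.univ : Finset (Fin L.length)).filter (fun i => f i ∈ Y), ?_, ?_⟩
  · refine le_trans (Finset.card_le_card_of_injOn f ?_ hf.injOn) hk
    intro i hi
    exact (Finset.mem_filter.1 (Finset.mem_coe.1 hi)).2
  · intro i j hij
    change kernelAdj D G L[i] L[j] = true at hij
    have hadj := (kernelAdj_iff.1 hij).1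
    obtain ⟨h₁, h₂, h₃⟩ := adj_iff.1 hadj
    rcases hY (f i) (f j) h₃ with h | h | h
    · exact .inl (Finset.mem_coe.2 (Finset.mem_filter.2 ⟨Finset.mem_univ _, h⟩))
    · exact .inr (.inl (Finset.mem_coe.2 (Finset.mem_filter.2 ⟨Finset.mem_univ _, h⟩)))
    · right; right
      have ht := (twin_iff_twins (hLn i) (hLn j)).2 h
      ext x
      change x = i ∨ kernelAdj D G L[i] L[x] = true ↔ x = j ∨ kernelAdj D G L[j] L[x] = true
      rw [← (⟨hinj x i, fun h => by rw [h]⟩ : L[x] = L[i] ↔ x = i),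
        ← (⟨hinj x j, fun h => by rw [h]⟩ : L[x] = L[j] ↔ x = j)]
      exact ⟨kernelAdj_of_twin (hLc i) (hLc j) ht,
        kernelAdj_of_twin (hLc j) (hLc i) (twin_symm ht)⟩

theorem isSubgraphOf_kernel (D : ℕ) (G : FinGraph) : IsSubgraphOf (kernel D G) G := by
  set L := kernelVerts D G with hL
  have hLn : ∀ i : Fin L.length, L[i] < G.n := fun i =>
    lt_of_mem_core (mem_kernelVerts.1 (List.getElem_mem i.2)).1
  let S : G.graph.Subgraph :=
    { verts := {x | x.val ∈ L}
      Adj := fun x y => x.val ∈ L ∧ y.val ∈ L ∧ kernelAdj D G x.val y.val = true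
      adj_sub := fun {x y} h => by
        obtain ⟨_, _, h⟩ := adj_iff.1 (kernelAdj_iff.1 h.2.2).1
        exact h
      edge_vert := fun h => h.1
      symm := ⟨fun x y h => ⟨h.2.1, h.1, kernelAdj_symm D G _ _ h.2.2⟩⟩ }
  let f : Fin L.length → S.verts := fun i => ⟨⟨L[i], hLn i⟩, List.getElem_mem i.2⟩
  have hf : Function.Bijective f := by
    constructor
    · intro i j hij
      have : L[i] = L[j] := congrArg (fun x : S.verts => x.1.1) hij
      exact Fin.ext ((nodup_kernelVerts.getElem_inj_iff).1 this)
    · rintro ⟨x, hx⟩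
      obtain ⟨i, hi, h⟩ := List.getElem_of_mem (show x.val ∈ L from hx)
      exact ⟨⟨i, hi⟩, Subtype.ext (Fin.ext h)⟩
  refine ⟨S, ⟨⟨Equiv.ofBijective f hf, ?_⟩⟩⟩
  intro i j
  change (L[i] ∈ L ∧ L[j] ∈ L ∧ kernelAdj D G L[i] L[j] = true) ↔ kernelAdj D G L[i] L[j] = true
  exact ⟨fun h => h.2.2, fun h => ⟨List.getElem_mem i.2, List.getElem_mem j.2, h⟩⟩

theorem HColorable.of_isSubgraphOf {W : Type*} {H : SimpleGraph W} {G G' : FinGraph}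
    (h : HColorable H G) (hs : IsSubgraphOf G' G) : HColorable H G' := by
  obtain ⟨f⟩ := h
  obtain ⟨S, ⟨e⟩⟩ := hs
  exact ⟨(f.comp S.hom).comp e.toHom⟩

/-! ### A coloring of the kernel extends to the graph -/

section
variable {W : Type*} {H : SimpleGraph W} {h : ℕ → W} {c : ℕ} {S T : Finset ℕ}

/-- There is a clique of `c` vertices of `H`, all of them adjacent to the colors of the vertices in
`S`. -/
def Extends (H : SimpleGraph W) (h : ℕ → W) (c : ℕ) (S : Finset ℕ) : Prop :=
  ∃ q : ℕ → W, (∀ i < c, ∀ j < c, i ≠ j → H.Adj (q i) (q j)) ∧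
    ∀ i < c, ∀ s ∈ S, H.Adj (q i) (h s)

theorem Extends.injOn_of_minimal [DecidableEq W] (hS : ¬ Extends H h c S)
    (hmin : ∀ s ∈ S, Extends H h c (S.erase s)) : Set.InjOn h S := by
  intro s hs t ht hst
  by_contra hne
  obtain ⟨q, hq, hqs⟩ := hmin s hs
  refine hS ⟨q, hq, fun i hi r hr => ?_⟩
  by_cases hrs : r = s
  · rw [hrs, hst]
    exact hqs i hi t (Finset.mem_erase.2 ⟨Ne.symm hne, ht⟩)
  · exact hqs i hi r (Finset.mem_erase.2 ⟨hrs, hr⟩)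

/-- Among the facets of a simplex that carries fewer colors than vertices, an even number carries
exactly the colors `B`, each of them once. -/
theorem sum_facets_eq_zero [DecidableEq W] {B : Finset W} (hS : S.card = B.card + 1)
    (him : (S.image h).card ≤ B.card) :
    ∑ s ∈ S, (if (S.erase s).image h = B then 1 else 0 : ZMod 2) = 0 := by
  by_cases hex : ∃ s ∈ S, (S.erase s).image h = B
  · obtain ⟨s, hs, hsB⟩ := hex
    have hcard : (S.erase s).card = B.card := by rw [Finset.card_erase_of_mem hs, hS]; rfl
    have hinj : Set.InjOn h (S.erase s) := by
      rw [← Finset.card_image_iff, hsB, hcard]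
    have hSB : S.image h = B := by
      refine (Finset.eq_of_subset_of_card_le ?_ him).symm
      rw [← hsB]
      exact Finset.image_subset_image (Finset.erase_subset _ _)
    have hhs : h s ∈ (S.erase s).image h := by
      rw [hsB, ← hSB]
      exact Finset.mem_image_of_mem h hs
    obtain ⟨t, ht, hts⟩ := Finset.mem_image.1 hhs
    obtain ⟨htne, htS⟩ := Finset.mem_erase.1 ht
    have hset : S.filter (fun r => (S.erase r).image h = B) = {s, t} := by
      ext r
      rw [Finset.mem_filter, Finset.mem_insert, Finset.mem_singleton]
      constructor
      · rintro ⟨hr, hrB⟩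
        by_contra hne
        push Not at hne
        have : h r ∈ (S.erase r).image h := by
          rw [hrB, ← hSB]
          exact Finset.mem_image_of_mem h hr
        obtain ⟨x, hx, hxr⟩ := Finset.mem_image.1 this
        obtain ⟨hxne, hxS⟩ := Finset.mem_erase.1 hx
        have hr' : r ∈ S.erase s := Finset.mem_erase.2 ⟨hne.1, hr⟩
        by_cases hxs : x = s
        · exact hne.2 (hinj hr' ht (by rw [hts, ← hxs, hxr]))
        · exact hxne (hinj (Finset.mem_erase.2 ⟨hxs, hxS⟩) hr' hxr)
      · rintro (rfl | rfl)
        · exact ⟨hs, hsB⟩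
        · refine ⟨htS, ?_⟩
          rw [← hSB]
          refine le_antisymm (Finset.image_subset_image (Finset.erase_subset _ _)) ?_
          intro x hx
          obtain ⟨y, hy, rfl⟩ := Finset.mem_image.1 hx
          by_cases hyr : y = r
          · rw [hyr, hts]
            exact Finset.mem_image_of_mem h (Finset.mem_erase.2 ⟨htne.symm, hs⟩)
          · exact Finset.mem_image_of_mem h (Finset.mem_erase.2 ⟨hyr, hy⟩)
    rw [Finset.sum_boole, hset, Finset.card_pair htne.symm]
    rfl
  · push Not at hex
    exact Finset.sum_eq_zero fun s hs => if_neg (hex s hs)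

theorem sum_facets_eq_one [DecidableEq W] {s : ℕ} (hs : s ∈ S) (hinj : Set.InjOn h S) :
    ∑ r ∈ S, (if (S.erase r).image h = (S.erase s).image h then 1 else 0 : ZMod 2) = 1 := by
  rw [Finset.sum_eq_single_of_mem s hs, if_pos rfl]
  intro r hr hrs
  rw [if_neg]
  intro he
  have : h r ∈ (S.erase r).image h := by
    rw [he]
    exact Finset.mem_image_of_mem h (Finset.mem_erase.2 ⟨hrs, hr⟩)
  obtain ⟨x, hx, hxr⟩ := Finset.mem_image.1 this
  obtain ⟨hxne, hxS⟩ := Finset.mem_erase.1 hx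
  exact hxne (hinj hxS hr hxr)

open Classical in
/-- The functional that detects violated constraints: at a unit vector, whether the coloring does
not extend; at a face of a simplex, whether its colors are the set `B`. -/
noncomputable def violation (H : SimpleGraph W) (h : ℕ → W) (B : Finset W)
    (k : List Unit × List ℕ) : ZMod 2 :=
  if k.1 = [] then (if k.2.toFinset.image h = B then 1 else 0)
  else (if Extends H h k.1.length k.2.toFinset then 0 else 1)

open Classical in
theorem evalFunctional_violation_simplex {D : ℕ} {B : Finset W} {c : List ℕ × List ℕ}
    (h₁ : c.1.length = 1) (h₂ : c.2.length = D + 1) (hn : c.2.Nodup) :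
    evalFunctional (violation H h B) (constraintVector D c) =
      ∑ s ∈ c.2.toFinset, (if (c.2.toFinset.erase s).image h = B then 1 else 0 : ZMod 2) := by
  have hv : constraintVector D c =
      c.2.map fun s => ([], c.2.filter fun t => !decide (t = s)) := by
    rw [constraintVector, if_pos]
    rw [Bool.and_eq_true, Bool.not_eq_true', List.isEmpty_iff, List.drop_eq_nil_iff,
      ← Bool.not_eq_true, List.isEmpty_iff, List.drop_eq_nil_iff]
    omega
  have hd := nodup_constraintVector D hn
  rw [hv] at hd ⊢
  rw [evalFunctional, List.sum_toFinset _ hd, List.map_map, List.sum_toFinset _ hn]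
  congr 1
  refine List.map_congr_left fun s _ => ?_
  have : (c.2.filter fun t => !decide (t = s)).toFinset = c.2.toFinset.erase s := by
    ext t
    simp [and_comm]
  simp [violation, this]

open Classical in
theorem evalFunctional_violation_unit {D : ℕ} {B : Finset W} {c : List ℕ × List ℕ}
    (h₀ : 1 ≤ c.1.length) (h₁ : ¬ (c.1.length = 1 ∧ D + 1 ≤ c.2.length)) :
    evalFunctional (violation H h B) (constraintVector D c) =
      if Extends H h c.1.length c.2.toFinset then 0 else 1 := by
  have hv : constraintVector D c = [(c.1.map fun _ => (), c.2)] := by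
    rw [constraintVector, if_neg]
    rw [Bool.and_eq_true, Bool.not_eq_true', List.isEmpty_iff, List.drop_eq_nil_iff,
      ← Bool.not_eq_true, List.isEmpty_iff, List.drop_eq_nil_iff]
    omega
  have hne : c.1 ≠ [] := List.ne_nil_of_length_pos h₀
  rw [hv]
  simp [evalFunctional, violation, hne]

variable {G : FinGraph}

/-- The coloring of the kernel satisfies the kept constraints. -/
theorem extends_of_kept {D : ℕ} (hh : ∀ u ∈ kernelVerts D G, ∀ v ∈ kernelVerts D G,
      kernelAdj D G u v = true → H.Adj (h u) (h v))
    {c : List ℕ × List ℕ} (hc : c ∈ keptConstraints D G) :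
    Extends H h c.1.length c.2.toFinset := by
  obtain ⟨v, hv, hvX, hK, -, hS, -⟩ := mem_constraints.1 (mem_constraints_of_kept hc)
  have hblock : ∀ x ∈ c.1, x ∈ core D G ∧ twin G v x = true := fun x hx =>
    mem_block.1 (hK ▸ hx)
  have hcore : ∀ i (hi : i < c.1.length), c.1[i] ∈ core D G ∧ twin G v c.1[i] = true :=
    fun i hi => hblock _ (List.getElem_mem hi)
  have hmem : ∀ i (hi : i < c.1.length), c.1[i] ∈ kernelVerts D G := fun i hi =>
    mem_kernelVerts.2 ⟨(hcore i hi).1, .inr ⟨c, hc, List.getElem_mem hi⟩⟩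
  have hnd : c.1.Nodup := hK ▸ nodup_block
  refine ⟨fun i => h (c.1.getD i 0), fun i hi j hj hij => ?_, fun i hi s hs => ?_⟩
  · simp only
    rw [List.getD_eq_getElem _ _ hi, List.getD_eq_getElem _ _ hj]
    refine hh _ (hmem i hi) _ (hmem j hj) (kernelAdj_iff.2 ?_)
    have ht := twin_trans (twin_symm (hcore i hi).2) (hcore j hj).2
    refine ⟨adj_of_twin (lt_of_mem_core (hcore j hj).1) ht fun he => hij ?_, .inr (.inl ht)⟩
    exact hnd.getElem_inj_iff.1 he
  · simp only
    rw [List.getD_eq_getElem _ _ hi]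
    rw [List.mem_toFinset] at hs
    obtain ⟨hsX, hvs⟩ := hS s hs
    have hsc := mem_core_of_mem_cover hsX
    refine hh _ (hmem i hi) _ (mem_kernelVerts.2 ⟨hsc, .inl hsX⟩) (kernelAdj_iff.2 ⟨?_, ?_⟩)
    · refine (adj_congr_twin (lt_of_mem_core hsc) (hcore i hi).2 (adj_ne hvs).symm ?_).1 hvs
      intro he
      have h₁ := (hcore i hi).2
      rw [← he] at h₁
      exact hvX (mem_cover_of_twin hsX hv (twin_symm h₁))
    · exact .inr (.inr (.inl (linked_iff.2 ⟨c, hc, List.getElem_mem hi, s, hs, twin_refl G s⟩)))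

variable [Fintype W] [DecidableRel H.Adj]

/-- A minimal set without an extension to a clique of size `c` is small, because the colors of all
but one of its elements, together with `c - 1` vertices of a clique, are neighbors of one vertex. -/
theorem Extends.card_le_of_minimal (hc : 1 ≤ c) (hne : S.Nonempty) (hS : ¬ Extends H h c S)
    (hmin : ∀ s ∈ S, Extends H h c (S.erase s)) : c + S.card ≤ H.maxDegree + 2 := by
  classical
  have hinj := injOn_of_minimal hS hmin
  obtain ⟨s, hs⟩ := hne
  obtain ⟨q, hq, hqs⟩ := hmin s hs
  set A := (S.erase s).image h
  set B := (Finset.Ico 1 c).image q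
  have hA : A.card = S.card - 1 := by
    rw [Finset.card_image_of_injOn (hinj.mono (by simp)), Finset.card_erase_of_mem hs]
  have hB : B.card = c - 1 := by
    rw [Finset.card_image_of_injOn, Nat.card_Ico]
    intro i hi j hj hij
    simp only [Finset.coe_Ico, Set.mem_Ico] at hi hj
    by_contra hne
    exact (hq i hi.2 j hj.2 hne).ne hij
  have hAB : Disjoint A B := by
    rw [Finset.disjoint_left]
    intro x hx hx'
    obtain ⟨t, ht, rfl⟩ := Finset.mem_image.1 hx
    obtain ⟨i, hi, hit⟩ := Finset.mem_image.1 hx'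
    exact (hqs i (Finset.mem_Ico.1 hi).2 t ht).ne hit
  have hsub : A ∪ B ⊆ H.neighborFinset (q 0) := by
    intro x hx
    rw [SimpleGraph.mem_neighborFinset]
    rcases Finset.mem_union.1 hx with hx | hx
    · obtain ⟨t, ht, rfl⟩ := Finset.mem_image.1 hx
      exact hqs 0 hc t ht
    · obtain ⟨i, hi, rfl⟩ := Finset.mem_image.1 hx
      rw [Finset.mem_Ico] at hi
      exact hq 0 hc i hi.2 (by omega)
  have hcard := Finset.card_le_card hsub
  rw [Finset.card_union_of_disjoint hAB, hA, hB, SimpleGraph.card_neighborFinset_eq_degree] at hcard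
  have := H.degree_le_maxDegree (q 0)
  have := Finset.card_pos.2 ⟨s, hs⟩
  omega

/-- The functional `violation` vanishes at the vectors of all constraints. -/
theorem evalFunctional_violation_eq_zero
    (hh : ∀ u ∈ kernelVerts H.maxDegree G, ∀ v ∈ kernelVerts H.maxDegree G,
      kernelAdj H.maxDegree G u v = true → H.Adj (h u) (h v))
    {B : Finset W} (hB : B.card = H.maxDegree) {c : List ℕ × List ℕ}
    (hc : c ∈ constraints H.maxDegree G) :
    evalFunctional (violation H h B) (constraintVector H.maxDegree c) = 0 := by
  classical
  refine evalFunctional_eq_zero_of_selectBasis _ (constraintVector H.maxDegree)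
    (constraints H.maxDegree G) (fun c hc => ?_) c hc
  have he := extends_of_kept hh hc
  obtain ⟨v, hv, -, hK, hn, -, hlen⟩ := mem_constraints.1 (mem_constraints_of_kept hc)
  have hpos : 1 ≤ c.1.length := hK ▸ List.length_pos_of_mem (mem_block_self hv)
  by_cases hs : c.1.length = 1 ∧ H.maxDegree + 1 ≤ c.2.length
  · have hS : c.2.length = H.maxDegree + 1 := by omega
    rw [evalFunctional_violation_simplex hs.1 hS hn]
    refine sum_facets_eq_zero (by rw [List.toFinset_card_of_nodup hn, hS, hB]) ?_
    obtain ⟨q, -, hq⟩ := he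
    have hsub : c.2.toFinset.image h ⊆ H.neighborFinset (q 0) := by
      intro x hx
      obtain ⟨s, hs, rfl⟩ := Finset.mem_image.1 hx
      rw [SimpleGraph.mem_neighborFinset]
      exact hq 0 hpos s hs
    rw [hB]
    refine (Finset.card_le_card hsub).trans ?_
    rw [SimpleGraph.card_neighborFinset_eq_degree]
    exact H.degree_le_maxDegree _
  · rw [evalFunctional_violation_unit hpos hs, if_pos he]

/-- The coloring of the cover extends to each class outside of it. -/
theorem extends_block
    (hh : ∀ u ∈ kernelVerts H.maxDegree G, ∀ v ∈ kernelVerts H.maxDegree G,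
      kernelAdj H.maxDegree G u v = true → H.Adj (h u) (h v))
    {v : ℕ} (hv : v ∈ core H.maxDegree G) (hvX : v ∉ cover H.maxDegree G) :
    Extends H h (block H.maxDegree G v).length
      ((cover H.maxDegree G).filter fun u => adj G v u).toFinset := by
  classical
  set D := H.maxDegree with hD
  set K := block D G v
  set N := ((cover D G).filter fun u => adj G v u).toFinset
  have hpos : 1 ≤ K.length := List.length_pos_of_mem (mem_block_self hv)
  by_contra hN
  obtain ⟨S, hSN, hS⟩ :=
    exists_minimal_le_of_wellFoundedLT (fun S : Finset ℕ => ¬ Extends H h K.length S) N hN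
  have hSb : ¬ Extends H h K.length S := hS.prop
  have hmin : ∀ s ∈ S, Extends H h K.length (S.erase s) := by
    intro s hs
    by_contra hb
    have := hS.le_of_le hb (Finset.erase_subset s S) hs
    simp at this
  have hinj := Extends.injOn_of_minimal hSb hmin
  have hcard : K.length + S.card ≤ D + 2 := by
    rcases S.eq_empty_or_nonempty with rfl | hne
    · simpa using length_block_le
    · exact Extends.card_le_of_minimal hpos hne hSb hmin
  have hc : (K, S.toList) ∈ constraints D G := by
    refine mem_constraints.2 ⟨v, hv, hvX, rfl, S.nodup_toList, fun s hs => ?_, by simpa⟩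
    have := hSN (Finset.mem_toList.1 hs)
    simpa [N] using this
  by_cases hs : K.length = 1 ∧ D + 1 ≤ S.toList.length
  · have hSc : S.card = D + 1 := by
      have := hs.2
      rw [Finset.length_toList] at this
      omega
    obtain ⟨s, hsS⟩ : S.Nonempty := Finset.card_pos.1 (by omega)
    have hB : ((S.erase s).image h).card = D := by
      rw [Finset.card_image_of_injOn (hinj.mono (by simp)), Finset.card_erase_of_mem hsS]
      omega
    have := evalFunctional_violation_eq_zero hh hB hc
    rw [evalFunctional_violation_simplex hs.1 (by simpa using hSc) S.nodup_toList,
      Finset.toList_toFinset, sum_facets_eq_one hsS hinj] at this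
    exact one_ne_zero this
  · obtain ⟨B, -, hB⟩ : ∃ B ⊆ (Finset.univ : Finset W), B.card = D := by
      apply Finset.exists_subset_card_eq
      have : Nonempty W := ⟨h 0⟩
      obtain ⟨w, hw⟩ := H.exists_maximal_degree_vertex
      rw [hD, hw]
      exact Finset.card_le_univ _
    have := evalFunctional_violation_eq_zero hh hB hc
    rw [evalFunctional_violation_unit hpos hs, Finset.toList_toFinset, if_neg hSb] at this
    exact one_ne_zero this

/-- A coloring of the core colors the whole graph, since no vertex is missing in the core. -/
theorem hColorable_of_core {g : ℕ → W}
    (hg : ∀ u ∈ core H.maxDegree G, ∀ v ∈ core H.maxDegree G,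
      adj G u v = true → H.Adj (g u) (g v)) : HColorable H G := by
  classical
  have hall : ∀ v < G.n, v ∈ core H.maxDegree G := by
    intro v hv
    by_contra hvc
    obtain ⟨u, hu, hlen⟩ := exists_length_block hv hvc
    have hadj : ∀ x ∈ block H.maxDegree G u, ∀ y ∈ block H.maxDegree G u, x ≠ y →
        H.Adj (g x) (g y) := by
      intro x hx y hy hxy
      rw [mem_block] at hx hy
      exact hg x hx.1 y hy.1
        (adj_of_twin (lt_of_mem_core hy.1) (twin_trans (twin_symm hx.2) hy.2) hxy)
    have huK := mem_block_self hu
    have hsub : ((block H.maxDegree G u).toFinset.erase u).image g ⊆ H.neighborFinset (g u) := by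
      intro x hx
      obtain ⟨y, hy, rfl⟩ := Finset.mem_image.1 hx
      rw [Finset.mem_erase, List.mem_toFinset] at hy
      rw [SimpleGraph.mem_neighborFinset]
      exact hadj u huK y hy.2 hy.1.symm
    have hcard := Finset.card_le_card hsub
    rw [Finset.card_image_of_injOn, Finset.card_erase_of_mem (by simpa using huK),
      List.toFinset_card_of_nodup nodup_block, hlen,
      SimpleGraph.card_neighborFinset_eq_degree] at hcard
    · have := H.degree_le_maxDegree (g u)
      omega
    · intro x hx y hy hxy
      by_contra hne
      simp only [Finset.coe_erase, List.coe_toFinset, Set.mem_sdiff, Set.mem_ofPred_eq] at hx hy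
      exact (hadj x hx.1 y hy.1 hne).ne hxy
  exact ⟨⟨fun v => g v.val, fun {u v} huv => hg _ (hall _ u.2) _ (hall _ v.2)
    (adj_iff.2 ⟨u.2, v.2, huv⟩)⟩⟩

theorem hColorable_of_kernelVerts
    (hh : ∀ u ∈ kernelVerts H.maxDegree G, ∀ v ∈ kernelVerts H.maxDegree G,
      kernelAdj H.maxDegree G u v = true → H.Adj (h u) (h v)) : HColorable H G := by
  classical
  set D := H.maxDegree with hD
  set X := cover D G
  let N : ℕ → Finset ℕ := fun v => (X.filter fun u => adj G v u).toFinset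
  -- The clique of colors is chosen as a function of data that twins share.
  let Q : ℕ → Finset ℕ → ℕ → W := fun c S =>
    if he : Extends H h c S then he.choose else h
  let g : ℕ → W := fun v =>
    if v ∈ X then h v else Q (block D G v).length (N v) ((block D G v).idxOf v)
  have hidx : ∀ v ∈ core D G, (block D G v).idxOf v < (block D G v).length := fun v hv =>
    List.idxOf_lt_length_of_mem (mem_block_self hv)
  have hQ : ∀ v ∈ core D G, v ∉ X →
      (∀ i < (block D G v).length, ∀ j < (block D G v).length, i ≠ j →
        H.Adj (Q (block D G v).length (N v) i) (Q (block D G v).length (N v) j)) ∧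
      ∀ i < (block D G v).length, ∀ s ∈ N v,
        H.Adj (Q (block D G v).length (N v) i) (h s) := by
    intro v hv hvX
    have he : Extends H h (block D G v).length (N v) := extends_block hh hv hvX
    simp only [Q, dif_pos he]
    exact he.choose_spec
  have hcross : ∀ u ∈ core D G, ∀ v ∈ X, u ∉ X → adj G u v = true → H.Adj (g u) (g v) := by
    intro u hu v hv huX ha
    simp only [g, if_neg huX, if_pos hv]
    exact (hQ u hu huX).2 _ (hidx u hu) v (by simp [N, hv, ha])
  refine hColorable_of_core (g := g) fun u hu v hv ha => ?_
  by_cases huX : u ∈ X <;> by_cases hvX : v ∈ X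
  · simp only [g, if_pos huX, if_pos hvX]
    exact hh u (mem_kernelVerts.2 ⟨hu, .inl huX⟩) v (mem_kernelVerts.2 ⟨hv, .inl hvX⟩)
      (kernelAdj_iff.2 ⟨ha, .inl ⟨huX, hvX⟩⟩)
  · exact (hcross v hv u huX hvX (adj_symm ha)).symm
  · exact hcross u hu v hvX huX ha
  · have ht : twin G u v = true := by
      by_contra ht
      rcases mem_cover_or_of_adj hu hv ha ht with h | h
      · exact huX h
      · exact hvX h
    have hb : block D G v = block D G u := (block_congr ht).symm
    have hN : N v = N u := by
      ext x
      simp only [N, List.mem_toFinset, List.mem_filter]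
      refine and_congr_right fun hx => ?_
      refine (adj_congr_twin (lt_of_mem_core (mem_core_of_mem_cover hx)) ht ?_ ?_).symm
      · exact fun he => huX (he ▸ hx)
      · exact fun he => hvX (he ▸ hx)
    simp only [g, if_neg huX, if_neg hvX, hN, hb]
    refine (hQ u hu huX).1 _ (hidx u hu) _ (hb ▸ hidx v hv) fun he => adj_ne ha ?_
    exact (List.idxOf_inj (mem_block_self hu)).1 he

theorem hColorable_kernel_iff [Nonempty W] :
    HColorable H (kernel H.maxDegree G) ↔ HColorable H G := by
  classical
  refine ⟨?_, fun h => h.of_isSubgraphOf (isSubgraphOf_kernel _ _)⟩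
  rintro ⟨f⟩
  set L := kernelVerts H.maxDegree G with hL
  let h : ℕ → W := fun v =>
    if hv : L.idxOf v < L.length then f (⟨L.idxOf v, hv⟩ : Fin L.length)
    else Classical.arbitrary W
  refine hColorable_of_kernelVerts (h := h) fun u hu v hv huv => ?_
  have hu' := List.idxOf_lt_length_of_mem hu
  have hv' := List.idxOf_lt_length_of_mem hv
  have hfu : h u = f (⟨L.idxOf u, hu'⟩ : Fin L.length) := dif_pos hu'
  have hfv : h v = f (⟨L.idxOf v, hv'⟩ : Fin L.length) := dif_pos hv'
  rw [hfu, hfv]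
  refine f.map_adj ?_
  change kernelAdj H.maxDegree G L[L.idxOf u] L[L.idxOf v] = true
  rwa [List.getElem_idxOf, List.getElem_idxOf]

end

/-! ### The size of the kernel -/

theorem length_flatMap_le {α β : Type*} {l : List α} {f : α → List β} {m : ℕ}
    (h : ∀ a ∈ l, (f a).length ≤ m) : (l.flatMap f).length ≤ l.length * m := by
  induction l with
  | nil => simp
  | cons a l ih =>
    have h₁ := h a (by simp)
    have h₂ := ih fun b hb => h b (by simp [hb])
    rw [List.flatMap_cons, List.length_append, List.length_cons, add_one_mul]
    omega

section
variable {D : ℕ} {G : FinGraph}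

theorem length_keptConstraints_le :
    (keptConstraints D G).length ≤ (D + 3) * ((cover D G).length + 1) ^ D := by
  refine (length_selectBasis_le _ (((Finset.range (D + 3)).image fun i => List.replicate i ()) ×ˢ
    (tuples D (cover D G)).toFinset) ?_).trans ?_
  · intro d hd k hk
    obtain ⟨c, hc, rfl⟩ := List.mem_map.1 hd
    obtain ⟨v, hv, hvX, hK, hn, hS, hlen⟩ := mem_constraints.1 hc
    have hpos : 1 ≤ c.1.length := hK ▸ List.length_pos_of_mem (mem_block_self hv)
    rw [Finset.mem_product, Finset.mem_image, List.mem_toFinset, mem_tuples]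
    simp only [constraintVector] at hk
    split_ifs at hk with hif
    · obtain ⟨s, hs, rfl⟩ := List.mem_map.1 hk
      refine ⟨⟨0, by simp, rfl⟩, ?_, hn.filter _, fun t ht => (hS t (List.mem_filter.1 ht).1).1⟩
      have : (c.2.filter fun t => !decide (t = s)).length < c.2.length :=
        List.length_filter_lt_length_iff_exists.2 ⟨s, hs, by simp⟩
      simp only
      omega
    · rw [List.mem_singleton] at hk
      subst hk
      refine ⟨⟨c.1.length, by rw [Finset.mem_range]; omega, by simp⟩, ?_, hn,
        fun t ht => (hS t ht).1⟩
      rw [Bool.and_eq_true, Bool.not_eq_true', List.isEmpty_iff, List.drop_eq_nil_iff,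
        ← Bool.not_eq_true, List.isEmpty_iff, List.drop_eq_nil_iff] at hif
      simp only
      omega
  · rw [Finset.card_product]
    refine Nat.mul_le_mul ?_ ?_
    · exact Finset.card_image_le.trans (by simp)
    · exact (List.toFinset_card_le _).trans (length_tuples_le _ _)

theorem length_fst_add_snd_le {c : List ℕ × List ℕ} (hc : c ∈ keptConstraints D G) :
    c.1.length + c.2.length ≤ D + 2 := by
  obtain ⟨_, _, _, _, _, _, h⟩ := mem_constraints.1 (mem_constraints_of_kept hc)
  exact h

theorem length_kernelVerts_le : (kernelVerts D G).length ≤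
    (cover D G).length + (keptConstraints D G).length * (D + 2) := by
  have hsub : kernelVerts D G ⊆ cover D G ++ (keptConstraints D G).flatMap Prod.fst := by
    intro v hv
    rcases (mem_kernelVerts.1 hv).2 with h | h
    · exact List.mem_append_left _ h
    · exact List.mem_append_right _ (List.mem_flatMap.2 h)
  refine (nodup_kernelVerts.subperm hsub).length_le.trans ?_
  rw [List.length_append]
  gcongr
  exact length_flatMap_le fun c hc => by have := length_fst_add_snd_le hc; omega

/-- The number of ordered pairs of adjacent vertices. -/
noncomputable def arcCount (G : FinGraph) : ℕ := {p : Fin G.n × Fin G.n | G.graph.Adj p.1 p.2}.ncard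

theorem arcCount_kernel_le : arcCount (kernel D G) ≤
    (cover D G).length ^ 2 + (kernelVerts D G).length * (D + 2) +
      2 * ((keptConstraints D G).length * (D + 2) ^ 3) := by
  classical
  set L := kernelVerts D G with hL
  set X := cover D G with hX
  set M : List (ℕ × ℕ) := (keptConstraints D G).flatMap fun c =>
    c.1.flatMap fun u => (c.2.flatMap fun s => block D G s).map fun v => (u, v) with hM
  set A : List (ℕ × ℕ) := ((X.flatMap fun u => X.map fun v => (u, v)) ++
    (L.flatMap fun u => (block D G u).map fun v => (u, v))) ++ (M ++ M.map Prod.swap) with hA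
  have hMmem : ∀ u v, v ∈ core D G → linked D G u v = true → (u, v) ∈ M := by
    intro u v hv h
    obtain ⟨c, hc, hu, s, hs, hsv⟩ := linked_iff.1 h
    simp only [hM, List.mem_flatMap, List.mem_map]
    exact ⟨c, hc, u, hu, v, ⟨s, hs, mem_block.2 ⟨hv, hsv⟩⟩, rfl⟩
  have hAmem : ∀ u ∈ L, ∀ v ∈ L, kernelAdj D G u v = true → (u, v) ∈ A := by
    intro u hu v hv h
    have huc := (mem_kernelVerts.1 hu).1
    have hvc := (mem_kernelVerts.1 hv).1
    simp only [hA, List.mem_append]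
    rcases (kernelAdj_iff.1 h).2 with h | h | h | h
    · left; left
      simp only [List.mem_flatMap, List.mem_map]
      exact ⟨u, h.1, v, h.2, rfl⟩
    · left; right
      simp only [List.mem_flatMap, List.mem_map]
      exact ⟨u, hu, v, mem_block.2 ⟨hvc, h⟩, rfl⟩
    · exact .inr (.inl (hMmem u v hvc h))
    · exact .inr (.inr (List.mem_map.2 ⟨(v, u), hMmem v u huc h, rfl⟩))
  have hle : arcCount (kernel D G) ≤ A.toFinset.card := by
    rw [← Set.ncard_coe_finset]
    let f : Fin L.length × Fin L.length → ℕ × ℕ := fun p => (L[p.1], L[p.2])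
    refine Set.ncard_le_ncard_of_injOn f ?_ ?_ (Finset.finite_toSet _)
    · rintro ⟨i, j⟩ hij
      rw [Finset.mem_coe, List.mem_toFinset]
      exact hAmem _ (List.getElem_mem _) _ (List.getElem_mem _) hij
    · rintro ⟨i, j⟩ - ⟨i', j'⟩ - h
      obtain ⟨h₁, h₂⟩ := Prod.mk.inj h
      exact Prod.ext (Fin.ext ((nodup_kernelVerts.getElem_inj_iff).1 h₁))
        (Fin.ext ((nodup_kernelVerts.getElem_inj_iff).1 h₂))
  refine hle.trans ((List.toFinset_card_le _).trans ?_)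
  have hMlen : M.length ≤ (keptConstraints D G).length * (D + 2) ^ 3 := by
    refine length_flatMap_le fun c hc => ?_
    have hlen := length_fst_add_snd_le hc
    refine (length_flatMap_le (m := (D + 2) * (D + 2)) fun u _ => ?_).trans ?_
    · rw [List.length_map]
      refine (length_flatMap_le fun s _ => length_block_le).trans ?_
      gcongr
      omega
    · calc c.1.length * ((D + 2) * (D + 2)) ≤ (D + 2) * ((D + 2) * (D + 2)) := by
            gcongr; omega
        _ = (D + 2) ^ 3 := by ring
  have h₁ : (X.flatMap fun u => X.map fun v => (u, v)).length ≤ X.length ^ 2 := by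
    rw [sq]
    exact length_flatMap_le fun u _ => by simp
  have h₂ : (L.flatMap fun u => (block D G u).map fun v => (u, v)).length ≤
      L.length * (D + 2) :=
    length_flatMap_le fun u _ => by rw [List.length_map]; exact length_block_le
  rw [hA, List.length_append, List.length_append, List.length_append, List.length_map]
  omega

theorem ncard_edgeSet_le (G : FinGraph) : G.graph.edgeSet.ncard ≤ arcCount G := by
  have h : G.graph.edgeSet ⊆
      (fun p : Fin G.n × Fin G.n => s(p.1, p.2)) '' {p | G.graph.Adj p.1 p.2} := by
    intro e
    induction e using Sym2.ind with
    | _ u v => exact fun h => ⟨(u, v), h, rfl⟩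
  exact (Set.ncard_le_ncard h (Set.toFinite _)).trans (Set.ncard_image_le (Set.toFinite _))

theorem length_encodeNat (m : ℕ) : (encodeNat m).length = 2 * Nat.size m + 2 := by
  rw [encodeNat, List.length_append, List.length_flatMap, ← Nat.size_eq_bits_len]
  simp [mul_comm]

theorem length_encodeGraph_le (G : FinGraph) :
    (encodeGraph G).length ≤ arcCount G * (2 * Nat.size G.n + 2) + 2 * G.n := by
  classical
  have harc : arcCount G = ((List.finRange G.n).map fun v => (neighborList G v).length).sum := by
    have h₁ : ∀ v, (neighborList G v).length = ∑ u, if G.graph.Adj v u then 1 else 0 := by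
      intro v
      rw [← Finset.card_filter, neighborList, ← List.toFinset_card_of_nodup
        ((List.nodup_finRange _).filter _)]
      congr 1
      ext u
      simp
    have h₂ : {p : Fin G.n × Fin G.n | G.graph.Adj p.1 p.2} =
        ((Finset.univ.filter fun p : Fin G.n × Fin G.n => G.graph.Adj p.1 p.2 :
          Finset (Fin G.n × Fin G.n)) : Set (Fin G.n × Fin G.n)) := by
      ext p; simp
    rw [arcCount, h₂, Set.ncard_coe_finset, Finset.card_filter, Fintype.sum_prod_type,
      ← Fin.sum_univ_def]
    exact Finset.sum_congr rfl fun v _ => (h₁ v).symm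
  rw [harc, encodeGraph]
  have key : ∀ l : List (Fin G.n), (l.flatMap fun v =>
      (neighborList G v).flatMap (fun u => encodeNat u.val) ++ [false, false]).length ≤
      (l.map fun v => (neighborList G v).length).sum * (2 * Nat.size G.n + 2) + 2 * l.length := by
    intro l
    induction l with
    | nil => simp
    | cons v l ih =>
      have h : ((neighborList G v).flatMap fun u => encodeNat u.val).length ≤
          (neighborList G v).length * (2 * Nat.size G.n + 2) := by
        refine length_flatMap_le fun u _ => ?_
        rw [length_encodeNat]
        have := Nat.size_le_size u.2.le
        omega
      rw [List.flatMap_cons, List.length_append, List.length_append, List.map_cons, List.sum_cons,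
        List.length_cons, add_mul]
      simp only [List.length_cons, List.length_nil] at ih ⊢
      omega
  simpa using key (List.finRange G.n)

theorem length_cover_le_of_hasTwinCover {k : ℕ} (h : HasTwinCover G k) :
    (cover D G).length ≤ 2 * (D + 2) * k := by
  obtain ⟨Y, hk, hY⟩ := h
  refine (length_cover_le (Y := Y.image Fin.val) fun u v ha ht => ?_).trans ?_
  · obtain ⟨hu, hv, ha⟩ := adj_iff.1 ha
    rw [twin_iff_twins hu hv] at ht
    rcases hY _ _ ha with h | h | h
    · exact .inl (Finset.mem_image_of_mem Fin.val (Finset.mem_coe.1 h))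
    · exact .inr (Finset.mem_image_of_mem Fin.val (Finset.mem_coe.1 h))
    · exact absurd h ht
  · gcongr
    exact Finset.card_image_le.trans hk

end

/-- The kernel has `O(k ^ D)` vertices and arcs, if `D ≥ 2`. -/
theorem exists_kernel_bound {D : ℕ} (hD : 2 ≤ D) : ∃ c : ℕ, ∀ (G : FinGraph) (k : ℕ), 1 ≤ k →
    HasTwinCover G k → (kernel D G).n ≤ c * k ^ D ∧ arcCount (kernel D G) ≤ c * k ^ D := by
  set a := (D + 3) * (2 * D + 5) ^ D with ha
  set b := 2 * D + 4 + a * (D + 2) with hb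
  refine ⟨b + ((2 * D + 4) ^ 2 + b * (D + 2) + 2 * (a * (D + 2) ^ 3)), fun G k hk hG => ?_⟩
  set N := k ^ D with hN
  have hX : (cover D G).length ≤ (2 * D + 4) * k := by
    refine (length_cover_le_of_hasTwinCover hG).trans (le_of_eq ?_)
    ring
  have hkN : k ≤ N := Nat.le_self_pow (by omega) k
  have hk2 : k ^ 2 ≤ N := Nat.pow_le_pow_right hk hD
  have hkept : (keptConstraints D G).length ≤ a * N := by
    refine length_keptConstraints_le.trans ?_
    rw [ha, mul_assoc, hN, ← mul_pow]
    gcongr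
    linarith
  have hV : (kernelVerts D G).length ≤ b * N :=
    calc (kernelVerts D G).length
        ≤ (cover D G).length + (keptConstraints D G).length * (D + 2) := length_kernelVerts_le
      _ ≤ (2 * D + 4) * N + a * N * (D + 2) := by
          gcongr
          exact hX.trans (by gcongr)
      _ = b * N := by rw [hb]; ring
  have hA : arcCount (kernel D G) ≤
      ((2 * D + 4) ^ 2 + b * (D + 2) + 2 * (a * (D + 2) ^ 3)) * N :=
    calc arcCount (kernel D G)
        ≤ (cover D G).length ^ 2 + (kernelVerts D G).length * (D + 2) +
          2 * ((keptConstraints D G).length * (D + 2) ^ 3) := arcCount_kernel_le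
      _ ≤ (2 * D + 4) ^ 2 * N + b * N * (D + 2) + 2 * (a * N * (D + 2) ^ 3) := by
          gcongr
          calc (cover D G).length ^ 2 ≤ ((2 * D + 4) * k) ^ 2 := by gcongr
            _ = (2 * D + 4) ^ 2 * k ^ 2 := by ring
            _ ≤ _ := by gcongr
      _ = _ := by ring
  exact ⟨hV.trans (Nat.mul_le_mul_right N (Nat.le_add_right _ _)),
    hA.trans (Nat.mul_le_mul_right N (Nat.le_add_left _ _))⟩

theorem size_le_mul_log {c D k n : ℕ} (hk : 2 ≤ k) (hn : n ≤ c * k ^ D) :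
    (Nat.size n : ℝ) ≤ (2 * c + 4 * D) * Real.log k := by
  have h₁ : Nat.size n ≤ c + D * Nat.size k := by
    rw [Nat.size_le, pow_add, mul_comm D, pow_mul]
    calc n ≤ c * k ^ D := hn
      _ < 2 ^ c * (2 ^ Nat.size k) ^ D := by
        refine Nat.mul_lt_mul_of_lt_of_le Nat.lt_two_pow_self ?_ (by positivity)
        gcongr
        exact (Nat.lt_size_self k).le
  have hlog2 := Real.log_two_gt_d9
  have hlogk : Real.log 2 ≤ Real.log k :=
    Real.log_le_log (by norm_num) (by exact_mod_cast hk)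
  have h₂ : (Nat.size k : ℝ) ≤ 4 * Real.log k := by
    obtain ⟨m, hm⟩ : ∃ m, Nat.size k = m + 1 :=
      Nat.exists_eq_add_one.2 (Nat.size_pos.2 (by omega))
    have h₃ : 2 ^ m ≤ k := Nat.lt_size.1 (by omega)
    have h₄ : (m : ℝ) * Real.log 2 ≤ Real.log k := by
      rw [← Real.log_pow]
      exact Real.log_le_log (by positivity) (by exact_mod_cast h₃)
    have h₅ : (0 : ℝ) ≤ m := m.cast_nonneg
    rw [hm]
    push_cast
    nlinarith
  have h₆ : (Nat.size n : ℝ) ≤ c + D * Nat.size k := by exact_mod_cast h₁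
  have h₇ : (D : ℝ) * Nat.size k ≤ D * (4 * Real.log k) := by gcongr
  have h₈ : (c : ℝ) * 1 ≤ c * (2 * Real.log k) := by
    gcongr
    linarith
  linarith

theorem exists_kernel_size_bound {D : ℕ} (hD : 2 ≤ D) :
    ∃ C : ℝ, ∀ (G : FinGraph) (k : ℕ), 2 ≤ k → HasTwinCover G k →
      ((kernel D G).n : ℝ) ≤ C * (k : ℝ) ^ D ∧
      ((kernel D G).graph.edgeSet.ncard : ℝ) ≤ C * (k : ℝ) ^ D ∧
      ((encodeGraph (kernel D G)).length : ℝ) ≤ C * ((k : ℝ) ^ D * Real.log k) := by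
  obtain ⟨c, hc⟩ := exists_kernel_bound hD
  set d : ℝ := c * (2 * (2 * c + 4 * D) + 4) + 4 * c with hd
  have hd0 : 0 ≤ d := by positivity
  refine ⟨c + d, fun G k hk hG => ?_⟩
  obtain ⟨h₁, h₂⟩ := hc G k (by omega) hG
  have h₁' : ((kernel D G).n : ℝ) ≤ c * (k : ℝ) ^ D := by exact_mod_cast h₁
  have h₂' : (arcCount (kernel D G) : ℝ) ≤ c * (k : ℝ) ^ D := by exact_mod_cast h₂
  have h₃ : ((kernel D G).graph.edgeSet.ncard : ℝ) ≤ arcCount (kernel D G) := by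
    exact_mod_cast ncard_edgeSet_le _
  have hle : (c : ℝ) * (k : ℝ) ^ D ≤ (c + d) * (k : ℝ) ^ D := by
    gcongr
    linarith
  refine ⟨h₁'.trans hle, (h₃.trans h₂').trans hle, ?_⟩
  have hlog2 := Real.log_two_gt_d9
  have hlogk : Real.log 2 ≤ Real.log k :=
    Real.log_le_log (by norm_num) (by exact_mod_cast hk)
  have hlog : 1 ≤ 2 * Real.log k := by linarith
  have h₄ : ((encodeGraph (kernel D G)).length : ℝ) ≤
      arcCount (kernel D G) * (2 * Nat.size (kernel D G).n + 2) + 2 * (kernel D G).n := by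
    exact_mod_cast length_encodeGraph_le _
  have h₅ := size_le_mul_log hk h₁
  calc ((encodeGraph (kernel D G)).length : ℝ)
      ≤ arcCount (kernel D G) * (2 * Nat.size (kernel D G).n + 2) + 2 * (kernel D G).n * 1 := by
        rw [mul_one]; exact h₄
    _ ≤ c * (k : ℝ) ^ D * (2 * ((2 * c + 4 * D) * Real.log k) + 2 * (2 * Real.log k)) +
        2 * (c * (k : ℝ) ^ D) * (2 * Real.log k) := by
        gcongr
        linarith
    _ = d * ((k : ℝ) ^ D * Real.log k) := by rw [hd]; ring
    _ ≤ (c + d) * ((k : ℝ) ^ D * Real.log k) := by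
        have : (0 : ℝ) ≤ c := c.cast_nonneg
        gcongr
        linarith

/-- A graph of maximum degree at most one is bipartite: the smaller end of each edge gets one color,
everything else the other. -/
theorem two_le_maxDegree {W : Type*} [Fintype W] {H : SimpleGraph W} [DecidableRel H.Adj]
    (hH : ¬ H.IsBipartite) : 2 ≤ H.maxDegree := by
  classical
  by_contra hlt
  have huniq : ∀ u v w, H.Adj u v → H.Adj u w → v = w := by
    intro u v w hv hw
    have hdeg : (H.neighborFinset u).card ≤ 1 := by
      rw [SimpleGraph.card_neighborFinset_eq_degree]
      have := H.degree_le_maxDegree u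
      omega
    exact Finset.card_le_one.1 hdeg v (by simpa using hv) w (by simpa using hw)
  let e := Fintype.equivFin W
  refine hH ⟨SimpleGraph.Coloring.mk
    (fun v => if ∃ u, H.Adj v u ∧ e v < e u then (0 : Fin 2) else 1) ?_⟩
  intro u v huv
  rcases lt_or_gt_of_ne (fun h => huv.ne (e.injective h) : e u ≠ e v) with h | h
  · rw [if_pos ⟨v, huv, h⟩, if_neg]
    · decide
    · rintro ⟨w, hw, hlt⟩
      rw [huniq v w u hw huv.symm] at hlt
      exact absurd hlt h.asymm
  · rw [if_neg, if_pos ⟨u, huv.symm, h⟩]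
    · decide
    · rintro ⟨w, hw, hlt⟩
      rw [huniq u w v hw huv] at hlt
      exact absurd hlt h.asymm

end TwinCoverKernel

open TwinCoverKernel in
theorem theorem1 {W : Type*} [Fintype W] (H : SimpleGraph W) [DecidableRel H.Adj]
    (hH : ¬ H.IsBipartite) :
    ∃ f : FinGraph → FinGraph,
      (∃ p : Prog, ComputesInPolyTime p f) ∧
      (∀ G : FinGraph, HColorable H (f G) ↔ HColorable H G) ∧
      (∀ G : FinGraph, IsSubgraphOf (f G) G) ∧
      (∀ (G : FinGraph) (k : ℕ), HasTwinCover G k → HasTwinCover (f G) k) ∧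
      (∃ C : ℝ, ∀ (G : FinGraph) (k : ℕ), 2 ≤ k → HasTwinCover G k →
        ((f G).n : ℝ) ≤ C * (k : ℝ) ^ H.maxDegree ∧
        ((f G).graph.edgeSet.ncard : ℝ) ≤ C * (k : ℝ) ^ H.maxDegree ∧
        ((encodeGraph (f G)).length : ℝ) ≤ C * ((k : ℝ) ^ H.maxDegree * Real.log k)) := by
  have hD := two_le_maxDegree hH
  have hW : Nonempty W := by
    by_contra hW
    rw [not_nonempty_iff] at hW
    simp at hD
  exact ⟨kernel H.maxDegree, (polyTime_kernel _).computesInPolyTime,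
    fun _ => hColorable_kernel_iff, isSubgraphOf_kernel _, fun _ _ h => hasTwinCover_kernel h,
    exists_kernel_size_bound hD⟩
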